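/- Let $n\ge 1$ and let $R_n(\mathbb{Z}\oplus\mathbb{Z})$ denote the affine algebraic variety (over $\mathbb{C}$, not necessarily irreducible) of all homomorphisms $\rho\colon \mathbb{Z}\oplus\mathbb{Z}\to SL(n,\mathbb{C})$; its regular functions are the polynomials in the entries of the matrices $\rho(\gamma)$, $\gamma\in\mathbb{Z}\oplus\mathbb{Z}$. Call $\mu\in\mathbb{Z}\oplus\mathbb{Z}$ *simple* (or primitive) if there exists $\lambda\in\mathbb{Z}\oplus\mathbb{Z}$ such that $(\mu,\lambda)$ is a basis of $\mathbb{Z}\oplus\mathbb{Z}$, and call $A\in SL(n,\mathbb{C})$ a *regular element* if its centralizer $Z(A)$ in $SL(n,\mathbb{C})$ has dimension $n-1$. Let $\rho\in R_n(\mathbb{Z}\oplus\mathbb{Z})$ and let $\mu\in\mathbb{Z}\oplus\mathbb{Z}$ be simple. If $\rho(\mu)$ is a regular element, then $\rho$ is a smooth point of $R_n(\mathbb{Z}\oplus\mathbb{Z})$, that is, the dimension of the Zariski tangent space of $R_n(\mathbb{Z}\oplus\mathbb{Z})$ at $\rho$ equals the local dimension at $\rho$ (the maximal dimension of the irreducible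 components containing $\rho$). Moreover, $\rho$ belongs to an irreducible component of $R_n(\mathbb{Z}\oplus\mathbb{Z})$ of dimension $(n+2)(n-1)$. -/

import Mathlib

open scoped MatrixGroups

namespace AffineVar

/-!
An affine algebraic set is handled as a set of points `X` together with its `ℂ`-algebra `𝒪` of
regular (polynomial) functions `X → ℂ`.  This algebra is reduced, as for a classical variety.
-/

variable {X : Type*}

/-- Zero locus of a set of functions. -/
def zeros (S : Set (X → ℂ)) : Set X := {x | ∀ f ∈ S, f x = 0}

/-- The Zariski topology: the closed sets are the zero loci of sets of regular functions. -/
@[reducible] def zariski (𝒪 : Subalgebra ℂ (X → ℂ)) : TopologicalSpace X :=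
  TopologicalSpace.ofClosed {Z | ∃ S : Set (X → ℂ), S ⊆ 𝒪 ∧ Z = zeros S}
    ⟨{1}, by simp, by ext x; simp [zeros]⟩
    (by
      intro A hA
      refine ⟨{f | f ∈ 𝒪 ∧ ∃ Z ∈ A, ∀ x ∈ Z, f x = 0}, fun f hf => hf.1, ?_⟩
      ext x
      constructor
      · rintro hx f ⟨-, Z, hZ, hf⟩
        exact hf x (hx Z hZ)
      · intro hx Z hZ
        obtain ⟨S, hS, rfl⟩ := hA hZ
        exact fun f hf => hx f ⟨hS hf, _, hZ, fun y hy => hy f hf⟩)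
    (by
      rintro _ ⟨S, hS, rfl⟩ _ ⟨T, hT, rfl⟩
      refine ⟨{h | ∃ f ∈ S, ∃ g ∈ T, h = f * g}, ?_, ?_⟩
      · rintro _ ⟨f, hf, g, hg, rfl⟩
        exact 𝒪.mul_mem (hS hf) (hT hg)
      · ext x
        constructor
        · rintro (hx | hx) _ ⟨f, hf, g, hg, rfl⟩
          · simp [hx f hf]
          · simp [hx g hg]
        · intro hx
          by_contra hcon
          simp only [Set.mem_union, not_or, zeros, Set.mem_ofPred_eq, not_forall] at hcon
          obtain ⟨⟨f, hf, hfx⟩, g, hg, hgx⟩ := hcon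
          have := hx (f * g) ⟨f, hf, g, hg, rfl⟩
          exact (mul_ne_zero hfx hgx) this)

/-- Restriction of functions on `X` to a subset `Z`. -/
def restrictHom (Z : Set X) : (X → ℂ) →ₐ[ℂ] (Z → ℂ) where
  toFun f := fun z => f z
  map_one' := rfl
  map_mul' _ _ := rfl
  map_zero' := rfl
  map_add' _ _ := rfl
  commutes' _ := rfl

/-- The coordinate ring of `Z ⊆ X`: the restrictions to `Z` of the regular functions on `X`. -/
def coordRing (𝒪 : Subalgebra ℂ (X → ℂ)) (Z : Set X) : Subalgebra ℂ (Z → ℂ) :=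
  𝒪.map (restrictHom Z)

/-- The dimension of an algebraic subset `Z ⊆ X`: the Krull dimension of its coordinate ring. -/
noncomputable def dim (𝒪 : Subalgebra ℂ (X → ℂ)) (Z : Set X) : WithBot ℕ∞ :=
  ringKrullDim (coordRing 𝒪 Z)

/-- The irreducible components of `X` for the Zariski topology. -/
def components (𝒪 : Subalgebra ℂ (X → ℂ)) : Set (Set X) :=
  @irreducibleComponents X (zariski 𝒪)

/-- The local dimension at `x`: the maximal dimension of the irreducible components
containing `x`. -/
noncomputable def localDim (𝒪 : Subalgebra ℂ (X → ℂ)) (x : X) : WithBot ℕ∞ :=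
  sSup {d | ∃ C ∈ components 𝒪, x ∈ C ∧ dim 𝒪 C = d}

/-- The Zariski tangent space at `x`: the derivations at `x` of the algebra of regular
functions. -/
def tangentSpace (𝒪 : Subalgebra ℂ (X → ℂ)) (x : X) : Submodule ℂ (Module.Dual ℂ 𝒪) where
  carrier := {v | ∀ f g : 𝒪, v (f * g) = (f : X → ℂ) x * v g + (g : X → ℂ) x * v f}
  zero_mem' := by simp
  add_mem' := by
    intro v w hv hw f g
    simp only [LinearMap.add_apply, hv f g, hw f g]
    ring
  smul_mem' := by
    intro c v hv f g
    simp only [LinearMap.smul_apply, hv f g, smul_eq_mul]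
    ring

/-- `x` is a smooth (nonsingular) point: the Zariski tangent space at `x` is finite dimensional
and its dimension is the local dimension at `x`. -/
def IsSmoothPoint (𝒪 : Subalgebra ℂ (X → ℂ)) (x : X) : Prop :=
  Module.Finite ℂ (tangentSpace 𝒪 x) ∧
    ((Module.finrank ℂ (tangentSpace 𝒪 x) : ℕ) : WithBot ℕ∞) = localDim 𝒪 x

end AffineVar

namespace RepVar

/-- Regular functions on `SL(n, ℂ)`: the polynomials in the matrix entries. -/
def slRegular (n : ℕ) : Subalgebra ℂ (SL(n, ℂ) → ℂ) :=
  Algebra.adjoin ℂ {f | ∃ i j : Fin n, f = fun A => A.1 i j}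

/-- `A ∈ SL(n, ℂ)` is a regular element: its centralizer in `SL(n, ℂ)` has dimension `n - 1`. -/
def IsRegularElement {n : ℕ} (A : SL(n, ℂ)) : Prop :=
  AffineVar.dim (slRegular n) (Subgroup.centralizer {A} : Set SL(n, ℂ)) = ((n - 1 : ℕ) : WithBot ℕ∞)

/-- The set `R_n(Γ)` of representations of `Γ` in `SL(n, ℂ)`. -/
abbrev Rep (n : ℕ) (Γ : Type*) [Group Γ] : Type _ := Γ →* SL(n, ℂ)

/-- Regular functions on `R_n(Γ)`: the polynomials in the entries of the matrices `ρ γ`, `γ ∈ Γ`.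
For a finitely generated group, the entries of the images of finitely many generators suffice,
because the entries of an inverse in `SL(n, ℂ)` are polynomials in the entries of the matrix;
so this is the usual structure of affine algebraic variety on `R_n(Γ)`. -/
def repRegular (n : ℕ) (Γ : Type*) [Group Γ] : Subalgebra ℂ (Rep n Γ → ℂ) :=
  Algebra.adjoin ℂ {f | ∃ (γ : Γ) (i j : Fin n), f = fun ρ => (ρ γ).1 i j}

/-- An element `μ` of `ℤ ⊕ ℤ` is simple (primitive) if it is part of a basis `(μ, ν)`. -/
def IsSimpleElement (μ : ℤ × ℤ) : Prop :=
  ∃ b : Module.Basis (Fin 2) ℤ (ℤ × ℤ), b 0 = μ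

end RepVar

/-! Complete `μ` to a basis and let `A`, `B` be the images of its two vectors, so that
representations are commuting pairs in `SL(n, ℂ)`. Regularity of `A` bounds the dimension of its
commutant among all matrices by `n` (`finrank_commutant_le_of_isRegularElement`). Hence `A` has a
cyclic vector `v` (`exists_krylov_det_ne_zero`), and every matrix commuting with `A` is a polynomial
in `A`; in particular `B = p(A)`. Cyclicity of `v`, that is `det (v, A v, …, A ^ (n - 1) v) ≠ 0`, is
an open condition on representations.

If `A` is perturbed to a matrix `A'` with distinct eigenvalues, then `(A', p(A'))` is simultaneously
diagonalizable and, once determinants are rescaled, is a representation near `(A, B)`. So the open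
set above lies in the closure of the diagonalizable representations
(`mem_closure_diagonalizableReps`). These form an irreducible set, since any two are joined by a
holomorphic curve over a connected domain (`isPrimeSet_diagonalizableReps`). Their closure is
therefore the only component through `ρ`.

Both dimensions equal `(n² - 1) + (n - 1) = (n + 2)(n - 1)`. On the component, `A` up to a scalar
shift and the nonconstant coefficients of `B` as a polynomial in `A` (scaled by the determinant
above) form a transcendence basis (`dim_mainComponent`). On the tangent space, `A⁻¹ dA` takes every
trace-zero value because `p(A)` follows any deformation of `A`; when `dA = 0`, `B⁻¹ dB` ranges over
the trace-zero matrices commuting with `A` (`finrank_tangent`). -/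

section DimensionTheory

/-! ### Krull dimension, integrality and transcendence bases. -/

theorem ringKrullDim_eq_of_isIntegral {R S : Type*} [CommRing R] [CommRing S] [Algebra R S]
    [Algebra.IsIntegral R S] (hinj : Function.Injective (algebraMap R S)) :
    ringKrullDim S = ringKrullDim R := by
  apply le_antisymm
  · refine Order.krullDim_le_of_strictMono (PrimeSpectrum.comap (algebraMap R S)) ?_
    intro P Q hPQ
    exact Ideal.IsIntegral.comap_lt_comap (R := R) hPQ
  -- A chain of primes of `R` lifts to `S`: lying over for its head, going up for the rest.
  · refine iSup_le fun l => ?_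
    obtain ⟨Q, -, hQ, hQl⟩ := Ideal.exists_ideal_over_prime_of_isIntegral l.head.asIdeal (⊥ : Ideal S)
      (by
        rw [← RingHom.ker_eq_comap_bot, (RingHom.injective_iff_ker_eq_bot _).mp hinj]
        exact bot_le)
    have : Q.LiesOver l.head.asIdeal := ⟨hQl.symm⟩
    obtain ⟨L, hL, -, -⟩ := Ideal.exists_ltSeries_of_hasGoingUp l Q
    rw [← hL]
    exact Order.LTSeries.length_le_krullDim L

theorem ringKrullDim_eq_card_of_injective_of_isIntegral {k R ι : Type*} [Field k] [CommRing R]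
    [Algebra k R] [Finite ι] (g : MvPolynomial ι k →ₐ[k] R) (hinj : Function.Injective g)
    (hint : ∀ y : R, IsIntegral g.range y) : ringKrullDim R = Nat.card ι := by
  have : Algebra.IsIntegral g.range R := ⟨hint⟩
  rw [ringKrullDim_eq_of_isIntegral (R := g.range) Subtype.val_injective,
    ← ringKrullDim_eq_of_ringEquiv (AlgEquiv.ofInjective g hinj).toRingEquiv,
    MvPolynomial.ringKrullDim_of_isNoetherianRing, ringKrullDim_eq_zero_of_field, zero_add]

/-- Noether normalization supplies one transcendence basis whose size is the Krull dimension; any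
two transcendence bases have the same cardinality. -/
theorem ringKrullDim_eq_card_of_isTranscendenceBasis {k R ι : Type*} [Field k] [CommRing R]
    [IsDomain R] [Algebra k R] [Algebra.FiniteType k R] [Finite ι] {x : ι → R}
    (hx : IsTranscendenceBasis k x) : ringKrullDim R = Nat.card ι := by
  obtain ⟨s, g, hinj, hint⟩ := exists_integral_inj_algHom_of_fg k R
  have hint' : ∀ y : R, IsIntegral g.range y := by
    intro y
    obtain ⟨p, hp, hpy⟩ := hint y
    refine ⟨p.map (g.rangeRestrict : MvPolynomial (Fin s) k →+* g.range), hp.map _, ?_⟩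
    rw [Polynomial.eval₂_map]
    exact hpy
  rw [ringKrullDim_eq_card_of_injective_of_isIntegral g hinj hint']
  have hrange : Algebra.adjoin k (Set.range fun i => g (MvPolynomial.X i)) = g.range := by
    rw [Algebra.adjoin_range_eq_range_aeval]
    congr 1
    ext i
    simp
  have hgb : IsTranscendenceBasis k fun i => g (MvPolynomial.X i) := by
    rw [isTranscendenceBasis_iff_algebraicIndependent_isAlgebraic, hrange]
    exact ⟨(MvPolynomial.algebraicIndependent_X (Fin s) k).map' hinj,
      ⟨fun y => (hint' y).isAlgebraic⟩⟩
  have h := congrArg Cardinal.toNat (hx.lift_cardinalMk_eq hgb)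
  simp only [Cardinal.toNat_lift] at h
  rw [Nat.card, Nat.card, h]

/-- `det (M + x)` is the value at `x` of the monic characteristic polynomial of `-M`, so prescribing
it is an integral equation for `x`. Condition `det = 1` thus recovers a scalar shift up to finitely
many choices. -/
theorem isIntegral_of_det_add_smul_one_mem {k S : Type*} [CommRing k] [CommRing S] [Nontrivial S]
    [Algebra k S] {n : ℕ} (hn : n ≠ 0) (S₀ : Subalgebra k S) (M : Matrix (Fin n) (Fin n) S)
    (hM : ∀ i j, M i j ∈ S₀) (x : S) (h : (M + x • (1 : Matrix (Fin n) (Fin n) S)).det ∈ S₀) :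
    IsIntegral S₀ x := by
  let M₀ : Matrix (Fin n) (Fin n) S₀ := fun i j => ⟨M i j, hM i j⟩
  have hpos : 0 < (-M₀).charpoly.degree := by
    rw [Matrix.charpoly_degree_eq_dim, Fintype.card_fin]
    exact_mod_cast Nat.pos_of_ne_zero hn
  refine ⟨(-M₀).charpoly - Polynomial.C ⟨_, h⟩, ?_, ?_⟩
  · exact (Matrix.charpoly_monic _).sub_of_left (Polynomial.degree_C_le.trans_lt hpos)
  · have hmap : (-M₀).map (algebraMap S₀ S) = -M := by
      ext i j
      rfl
    rw [Polynomial.eval₂_sub, Polynomial.eval₂_C, Polynomial.eval₂_eq_eval_map,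
      ← Matrix.charpoly_map, hmap, Matrix.eval_charpoly, sub_eq_zero]
    have hx : Matrix.scalar (Fin n) x = x • (1 : Matrix (Fin n) (Fin n) S) := by
      rw [Matrix.smul_one_eq_diagonal]
      rfl
    rw [hx, sub_neg_eq_add, add_comm]
    rfl

end DimensionTheory

/-! ### Cyclic vectors and commutants. -/

section CyclicVectors

open Matrix Polynomial

variable {n : ℕ}

/-- The matrix with columns `v, A v, …, A ^ (n - 1) v`. -/
def krylov {R : Type*} [CommRing R] (A : Matrix (Fin n) (Fin n) R) (v : Fin n → R) :
    Matrix (Fin n) (Fin n) R :=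
  .of fun i j => (A ^ (j : ℕ) *ᵥ v) i

/-- The space of matrices commuting with `A`. -/
def commutant (A : Matrix (Fin n) (Fin n) ℂ) : Submodule ℂ (Matrix (Fin n) (Fin n) ℂ) :=
  Subalgebra.toSubmodule (Subalgebra.centralizer ℂ {A})

theorem mem_commutant {A X : Matrix (Fin n) (Fin n) ℂ} : X ∈ commutant A ↔ A * X = X * A := by
  simp [commutant, Subalgebra.mem_centralizer_iff]

theorem krylov_mulVec {R : Type*} [CommRing R] (A : Matrix (Fin n) (Fin n) R) (v c : Fin n → R) :
    krylov A v *ᵥ c = (∑ i, c i • A ^ (i : ℕ)) *ᵥ v := by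
  ext i
  simp only [krylov, mulVec, dotProduct, of_apply, Matrix.sum_apply, Matrix.smul_apply, smul_eq_mul,
    Finset.sum_mul]
  rw [Finset.sum_comm]
  refine Finset.sum_congr rfl fun j _ => Finset.sum_congr rfl fun k _ => ?_
  ring

theorem pow_mulVec_eq_krylov_col {R : Type*} [CommRing R] (A : Matrix (Fin n) (Fin n) R)
    (v : Fin n → R) (j : Fin n) : A ^ (j : ℕ) *ᵥ v = krylov A v *ᵥ Pi.single j 1 := by
  ext i
  simp [krylov]

theorem commute_sum_smul_pow {R : Type*} [CommRing R] (A : Matrix (Fin n) (Fin n) R)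
    (c : Fin n → R) : Commute A (∑ i, c i • A ^ (i : ℕ)) :=
  Commute.sum_right _ _ _ fun i _ => ((Commute.refl A).pow_right i).smul_right (c i)

/-- Commuting with `A` and killing `v`, `Y` kills every `A ^ j v`, the columns of an invertible
matrix over the fraction field; the adjugate avoids passing to that field. -/
theorem eq_zero_of_commute_of_mulVec_eq_zero {R : Type*} [CommRing R] [IsDomain R]
    {A Y : Matrix (Fin n) (Fin n) R} {v : Fin n → R} (hdet : (krylov A v).det ≠ 0)
    (hY : Commute A Y) (hYv : Y *ᵥ v = 0) : Y = 0 := by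
  have h : Y * krylov A v = 0 := by
    refine Matrix.ext_of_mulVec_single fun j => ?_
    rw [← mulVec_mulVec, ← pow_mulVec_eq_krylov_col, mulVec_mulVec, ← (hY.pow_left j).eq,
      ← mulVec_mulVec, hYv, mulVec_zero, zero_mulVec]
  have h2 : (krylov A v).det • Y = 0 := by
    rw [← mul_one Y, ← mul_smul_comm, ← mul_adjugate, ← mul_assoc, h, zero_mul]
  ext i j
  have h3 := congrFun (congrFun h2 i) j
  exact (mul_eq_zero.mp h3).resolve_left hdet

/-- Up to the factor `det (krylov A v)`, the coefficients of `X` as a polynomial in `A`. -/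
def krylovCoeff {R : Type*} [CommRing R] (A : Matrix (Fin n) (Fin n) R) (v : Fin n → R)
    (X : Matrix (Fin n) (Fin n) R) : Fin n → R :=
  (krylov A v).adjugate *ᵥ (X *ᵥ v)

/-- Both sides commute with `A` and agree on `v`. No division occurs, so the identity also serves
over coordinate rings. -/
theorem sum_krylovCoeff_smul_pow {R : Type*} [CommRing R] [IsDomain R]
    {A X : Matrix (Fin n) (Fin n) R} {v : Fin n → R} (hdet : (krylov A v).det ≠ 0) (hX : Commute A X) :
    ∑ i, krylovCoeff A v X i • A ^ (i : ℕ) = (krylov A v).det • X := by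
  rw [← sub_eq_zero]
  refine eq_zero_of_commute_of_mulVec_eq_zero hdet
    ((commute_sum_smul_pow A _).sub_right (hX.smul_right _)) ?_
  rw [sub_mulVec, ← krylov_mulVec, krylovCoeff, mulVec_mulVec, mul_adjugate, smul_mulVec,
    smul_mulVec, one_mulVec, sub_self]

theorem map_krylov {R S : Type*} [CommRing R] [CommRing S] (f : R →+* S)
    (A : Matrix (Fin n) (Fin n) R) (v : Fin n → R) :
    (krylov A v).map f = krylov (A.map f) (f ∘ v) := by
  ext i j
  have h : A.map f ^ (j : ℕ) = (A ^ (j : ℕ)).map f := (map_pow f.mapMatrix A j).symm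
  simp only [krylov, Matrix.map_apply, of_apply, h]
  exact RingHom.map_mulVec f _ _ _

theorem map_krylovCoeff {R S : Type*} [CommRing R] [CommRing S] (f : R →+* S)
    (A X : Matrix (Fin n) (Fin n) R) (v : Fin n → R) (i : Fin n) :
    f (krylovCoeff A v X i) = krylovCoeff (A.map f) (f ∘ v) (X.map f) i := by
  have h : (krylov (A.map f) (f ∘ v)).adjugate = (krylov A v).adjugate.map f := by
    rw [← map_krylov]
    exact (RingHom.map_adjugate f _).symm
  have h2 : X.map f *ᵥ (f ∘ v) = f ∘ (X *ᵥ v) := funext fun j => (RingHom.map_mulVec f X v j).symm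
  rw [krylovCoeff, krylovCoeff, h, h2]
  exact RingHom.map_mulVec f _ _ _

theorem krylovCoeff_sum_smul_pow {R : Type*} [CommRing R] (A : Matrix (Fin n) (Fin n) R)
    (v c : Fin n → R) :
    krylovCoeff A v (∑ i, c i • A ^ (i : ℕ)) = (krylov A v).det • c := by
  rw [krylovCoeff, ← krylov_mulVec, mulVec_mulVec, adjugate_mul, smul_mulVec, one_mulVec]

theorem exists_eq_sum_smul_pow {K : Type*} [Field K] {A X : Matrix (Fin n) (Fin n) K}
    {v : Fin n → K} (hdet : (krylov A v).det ≠ 0) (hX : Commute A X) :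
    ∃ c : Fin n → K, X = ∑ i, c i • A ^ (i : ℕ) := by
  refine ⟨(krylov A v).det⁻¹ • krylovCoeff A v X, ?_⟩
  simp only [Pi.smul_apply, smul_assoc]
  rw [← Finset.smul_sum, sum_krylovCoeff_smul_pow hdet hX, smul_smul, inv_mul_cancel₀ hdet, one_smul]

/-- By the binomial theorem a scalar shift of `A` multiplies the Krylov matrix by a unipotent upper
triangular matrix. -/
theorem krylov_add_smul_one_det {R : Type*} [CommRing R] (A : Matrix (Fin n) (Fin n) R)
    (v : Fin n → R) (x : R) : (krylov (A + x • 1) v).det = (krylov A v).det := by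
  let U : Matrix (Fin n) (Fin n) R :=
    .of fun i j => ((j : ℕ).choose i : R) * x ^ ((j : ℕ) - i)
  have hU : U.det = 1 := by
    rw [Matrix.det_of_isUpperTriangular]
    · simp [U]
    · intro i j hij
      simp only [id_eq] at hij
      simp [U, Nat.choose_eq_zero_of_lt (show (j : ℕ) < i from hij)]
  have h : krylov (A + x • 1) v = krylov A v * U := by
    refine Matrix.ext_of_mulVec_single fun j => ?_
    rw [← pow_mulVec_eq_krylov_col, ← mulVec_mulVec, krylov_mulVec]
    congr 1
    have hc : Commute A (x • (1 : Matrix (Fin n) (Fin n) R)) := (Commute.one_right A).smul_right x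
    have hterm : ∀ i : Fin n, (U *ᵥ Pi.single j 1) i • A ^ (i : ℕ) =
        (fun m : ℕ => (((j : ℕ).choose m : R) * x ^ ((j : ℕ) - m)) • A ^ m) i := fun i => by
      simp [U]
    rw [hc.add_pow, Finset.sum_congr rfl fun i _ => hterm i,
      Fin.sum_univ_eq_sum_range (fun m : ℕ => (((j : ℕ).choose m : R) * x ^ ((j : ℕ) - m)) • A ^ m) n,
      ← Finset.sum_subset (Finset.range_subset_range.mpr (Nat.succ_le_of_lt j.2))]
    · refine Finset.sum_congr rfl fun m _ => ?_
      rw [_root_.smul_pow, one_pow, mul_smul_comm, mul_one, ← nsmul_eq_mul', ← Nat.cast_smul_eq_nsmul R,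
        smul_smul]
    · intro m _ hm
      rw [Finset.mem_range, not_lt] at hm
      rw [Nat.choose_eq_zero_of_lt (Nat.lt_of_succ_le hm)]
      simp
  rw [h, det_mul, hU, mul_one]

/-- Over the principal ideal domain `ℂ[X]`, some element of the module defined by `A` has the
annihilator of the whole module. -/
theorem exists_mulVec_eq_zero_imp (A : Matrix (Fin n) (Fin n) ℂ) :
    ∃ v : Fin n → ℂ, ∀ p : ℂ[X], aeval A p *ᵥ v = 0 → aeval A p = 0 := by
  obtain ⟨x, hx⟩ := Module.exists_ker_toSpanSingleton_eq_annihilator (R := ℂ[X])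
    (M := Module.AEval ℂ (Fin n → ℂ) (Matrix.toLin' A))
  have hA : ∀ p : ℂ[X], aeval (Matrix.toLin' A) p = Matrix.toLin' (aeval A p) := fun p =>
    Polynomial.aeval_algHom_apply (Matrix.toLinAlgEquiv' : Matrix (Fin n) (Fin n) ℂ ≃ₐ[ℂ] _) A p
  refine ⟨(Module.AEval.of ℂ (Fin n → ℂ) (Matrix.toLin' A)).symm x, fun p hp => ?_⟩
  have h1 : p ∈ LinearMap.ker (LinearMap.toSpanSingleton ℂ[X] _ x) := by
    rw [LinearMap.mem_ker, LinearMap.toSpanSingleton_apply,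
      ← (Module.AEval.of ℂ (Fin n → ℂ) (Matrix.toLin' A)).symm.map_eq_zero_iff,
      Module.AEval.of_symm_smul, hA]
    exact hp
  rw [hx, Module.AEval.annihilator_eq_ker_aeval, RingHom.mem_ker] at h1
  have h2 : Matrix.toLin' (aeval A p) = 0 := by rw [← hA]; exact h1
  simpa using h2

/-- The matrices `∑_{i + j = k - 1} A ^ i * W * A ^ j`. -/
def conjSum (A W : Matrix (Fin n) (Fin n) ℂ) : ℕ → Matrix (Fin n) (Fin n) ℂ
  | 0 => 0
  | k + 1 => A * conjSum A W k + W * A ^ k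

/-- The sum telescopes. Weighted by the coefficients of the minimal polynomial, the right-hand sides
add up to `0`, which yields elements of the commutant. -/
theorem mul_conjSum_sub (A W : Matrix (Fin n) (Fin n) ℂ) (k : ℕ) :
    A * conjSum A W k - conjSum A W k * A = A ^ k * W - W * A ^ k := by
  induction k with
  | zero => simp [conjSum]
  | succ k ih =>
    have h : A * conjSum A W (k + 1) - conjSum A W (k + 1) * A =
        A * (A * conjSum A W k - conjSum A W k * A) + A * W * A ^ k - W * A ^ k * A := by
      rw [conjSum]
      noncomm_ring
    rw [h, ih, mul_sub, ← mul_assoc, ← pow_succ', ← mul_assoc, mul_assoc W, ← pow_succ]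
    abel

theorem conjSum_mulVec (A : Matrix (Fin n) (Fin n) ℂ) (w φ v : Fin n → ℂ) (m : ℕ)
    (hφ : ∀ j < m, φ ⬝ᵥ (A ^ j *ᵥ v) = 0) : ∀ k ≤ m, conjSum A (vecMulVec w φ) k *ᵥ v = 0 := by
  intro k hk
  induction k with
  | zero => simp [conjSum]
  | succ k ih =>
    rw [conjSum, add_mulVec, ← mulVec_mulVec, ih (by omega), ← mulVec_mulVec, vecMulVec_mulVec,
      hφ k (by omega)]
    simp

theorem conjSum_mulVec_eq_aeval (A : Matrix (Fin n) (Fin n) ℂ) (w φ u : Fin n → ℂ) (k : ℕ) :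
    ∃ p : ℂ[X], conjSum A (vecMulVec w φ) k *ᵥ u = aeval A p *ᵥ w := by
  induction k with
  | zero => exact ⟨0, by simp [conjSum]⟩
  | succ k ih =>
    obtain ⟨p, hp⟩ := ih
    refine ⟨X * p + C (φ ⬝ᵥ (A ^ k *ᵥ u)), ?_⟩
    rw [conjSum, add_mulVec, ← mulVec_mulVec, hp, ← mulVec_mulVec, vecMulVec_mulVec, map_add,
      map_mul, aeval_X, aeval_C, add_mulVec, mulVec_mulVec, Algebra.algebraMap_eq_smul_one,
      smul_mulVec, one_mulVec]
    simp

/-- For each `w` a matrix `T w` commuting with `A` and sending `v` to `w` is built from the minimal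
polynomial. The bound on the commutant makes evaluation at `v` injective, so `T v = 1`; but the
image of `T v` lies in `ℂ[A] v`, so `v` is cyclic. -/
theorem exists_krylov_det_ne_zero (A : Matrix (Fin n) (Fin n) ℂ)
    (hA : Module.finrank ℂ (commutant A) ≤ n) :
    ∃ v : Fin n → ℂ, (krylov A v).det ≠ 0 := by
  obtain ⟨v, hv⟩ := exists_mulVec_eq_zero_imp A
  refine ⟨v, ?_⟩
  rcases Nat.eq_zero_or_pos n with rfl | hn
  · simp
  have : Nonempty (Fin n) := ⟨⟨0, hn⟩⟩
  have hint : IsIntegral ℂ A := Matrix.isIntegral A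
  obtain ⟨m, hm⟩ : ∃ m, (minpoly ℂ A).natDegree = m + 1 :=
    Nat.exists_eq_succ_of_ne_zero (minpoly.natDegree_pos hint).ne'
  -- The vectors `v, …, A ^ m v` are independent because only multiples of the minimal polynomial,
  -- of degree `m + 1`, kill `v`; `φ` is the coordinate along the last.
  obtain ⟨φ, hφ₀, hφ₁⟩ : ∃ φ : Fin n → ℂ, (∀ j < m, φ ⬝ᵥ (A ^ j *ᵥ v) = 0) ∧
      φ ⬝ᵥ (A ^ m *ᵥ v) = 1 := by
    let f : degreeLT ℂ (m + 1) →ₗ[ℂ] (Fin n → ℂ) :=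
      (LinearMap.applyₗ v ∘ₗ (Matrix.toLin' (R := ℂ)).toLinearMap ∘ₗ (aeval A).toLinearMap) ∘ₗ
        (degreeLT ℂ (m + 1)).subtype
    have hf : ∀ p : degreeLT ℂ (m + 1), f p = aeval A (p : ℂ[X]) *ᵥ v := fun p => rfl
    have hker : LinearMap.ker f = ⊥ := by
      rw [LinearMap.ker_eq_bot']
      intro p hp
      rw [hf] at hp
      have h0 := minpoly.dvd ℂ A (hv _ hp)
      have hdeg := mem_degreeLT.mp p.2
      by_contra hne
      have hne' : (p : ℂ[X]) ≠ 0 := fun h => hne (Subtype.ext h)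
      have h1 := natDegree_le_of_dvd h0 hne'
      rw [degree_eq_natDegree hne', Nat.cast_lt] at hdeg
      omega
    obtain ⟨g, hg⟩ := f.exists_leftInverse_of_injective hker
    let ψ : (Fin n → ℂ) →ₗ[ℂ] ℂ := lcoeff ℂ m ∘ₗ (degreeLT ℂ (m + 1)).subtype ∘ₗ g
    have hψ : ∀ j ≤ m, ψ (A ^ j *ᵥ v) = if j = m then 1 else 0 := by
      intro j hj
      have hX : (X ^ j : ℂ[X]) ∈ degreeLT ℂ (m + 1) := by
        rw [mem_degreeLT, degree_X_pow]
        exact_mod_cast Nat.lt_succ_of_le hj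
      have h1 : A ^ j *ᵥ v = f ⟨X ^ j, hX⟩ := by rw [hf]; simp
      have h2 : g (f ⟨X ^ j, hX⟩) = ⟨X ^ j, hX⟩ := LinearMap.congr_fun hg _
      rw [h1]
      simp only [ψ, LinearMap.comp_apply, h2, Submodule.subtype_apply, lcoeff_apply, coeff_X_pow]
      simp only [eq_comm]
    have hdot : ∀ u, (fun i => ψ (Pi.single i 1)) ⬝ᵥ u = ψ u := by
      intro u
      rw [LinearMap.pi_apply_eq_sum_univ ψ u, dotProduct]
      refine Finset.sum_congr rfl fun i _ => ?_
      rw [smul_eq_mul, mul_comm]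
      congr 2
      ext j
      simp [Pi.single_apply, eq_comm]
    exact ⟨fun i => ψ (Pi.single i 1), fun j hj => by rw [hdot, hψ j hj.le, if_neg hj.ne],
      by rw [hdot, hψ m le_rfl, if_pos rfl]⟩
  let T : (Fin n → ℂ) → Matrix (Fin n) (Fin n) ℂ := fun w =>
    ∑ k ∈ Finset.range (m + 2), (minpoly ℂ A).coeff k • conjSum A (vecMulVec w φ) k
  have hmin : ∑ k ∈ Finset.range (m + 2), (minpoly ℂ A).coeff k • A ^ k = 0 := by
    rw [← show (minpoly ℂ A).natDegree + 1 = m + 2 by omega, ← aeval_eq_sum_range, minpoly.aeval]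
  have hTmem : ∀ w, T w ∈ commutant A := by
    intro w
    rw [mem_commutant, ← sub_eq_zero]
    simp only [T, Finset.mul_sum, Finset.sum_mul, mul_smul_comm, smul_mul_assoc,
      ← Finset.sum_sub_distrib, ← smul_sub, mul_conjSum_sub]
    simp only [smul_sub, Finset.sum_sub_distrib]
    simp only [← smul_mul_assoc, ← Finset.sum_mul, hmin]
    simp only [smul_mul_assoc, ← mul_smul_comm, ← Finset.mul_sum, hmin]
    simp
  have hTv : ∀ w, T w *ᵥ v = w := by
    intro w
    simp only [T, Matrix.sum_mulVec, smul_mulVec]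
    -- Only the leading term `k = m + 1` survives on `v`, and there the minimal polynomial has
    -- coefficient `1`.
    rw [Finset.sum_range_succ, Finset.sum_eq_zero, zero_add]
    · have hlead : (minpoly ℂ A).coeff (m + 1) = 1 := by
        rw [← hm]; exact minpoly.monic hint
      rw [hlead, one_smul, conjSum, add_mulVec, ← mulVec_mulVec,
        conjSum_mulVec A w φ v m hφ₀ m le_rfl, ← mulVec_mulVec, vecMulVec_mulVec, hφ₁]
      simp
    · intro k hk
      rw [conjSum_mulVec A w φ v m hφ₀ k (Nat.lt_succ_iff.mp (Finset.mem_range.mp hk)), smul_zero]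
  let ev : commutant A →ₗ[ℂ] (Fin n → ℂ) :=
    LinearMap.applyₗ v ∘ₗ (Matrix.toLin' (R := ℂ)).toLinearMap ∘ₗ (commutant A).subtype
  have hsurj : Function.Surjective ev := fun w => ⟨⟨T w, hTmem w⟩, hTv w⟩
  have hrank : Module.finrank ℂ (commutant A) = Module.finrank ℂ (Fin n → ℂ) := by
    refine le_antisymm ?_ (LinearMap.finrank_le_finrank_of_surjective hsurj)
    rwa [Module.finrank_fin_fun]
  have hinj := (LinearMap.injective_iff_surjective_of_finrank_eq_finrank hrank).mpr hsurj
  have hone : T v = 1 := by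
    have h1 : (⟨T v, hTmem v⟩ : commutant A) = ⟨1, mem_commutant.mpr (by simp)⟩ := by
      apply hinj
      change T v *ᵥ v = 1 *ᵥ v
      rw [hTv, one_mulVec]
    exact congrArg Subtype.val h1
  have hcyc : ∀ u, ∃ p : ℂ[X], u = aeval A p *ᵥ v := by
    intro u
    choose p hp using conjSum_mulVec_eq_aeval A v φ u
    refine ⟨∑ k ∈ Finset.range (m + 2), (minpoly ℂ A).coeff k • p k, ?_⟩
    conv_lhs => rw [← one_mulVec u, ← hone]
    simp only [T, Matrix.sum_mulVec, smul_mulVec, hp, map_sum, map_smul]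
  rw [← isUnit_iff_ne_zero, ← Matrix.isUnit_iff_isUnit_det, ← Matrix.mulVec_surjective_iff_isUnit]
  intro u
  obtain ⟨p, rfl⟩ := hcyc u
  -- By Cayley–Hamilton `p` may be reduced to degree less than `n`.
  refine ⟨fun i => (p %ₘ A.charpoly).coeff i, ?_⟩
  rw [krylov_mulVec, Matrix.aeval_eq_aeval_mod_charpoly]
  congr 1
  rw [aeval_eq_sum_range' (n := n),
    Fin.sum_univ_eq_sum_range (fun i => (p %ₘ A.charpoly).coeff i • A ^ i)]
  have h := natDegree_modByMonic_lt p A.charpoly_monic (by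
    intro h
    have := A.charpoly_natDegree_eq_dim
    rw [h, natDegree_one, Fintype.card_fin] at this
    omega)
  rwa [A.charpoly_natDegree_eq_dim, Fintype.card_fin] at h

theorem finrank_commutant {A : Matrix (Fin n) (Fin n) ℂ} {v : Fin n → ℂ}
    (hdet : (krylov A v).det ≠ 0) : Module.finrank ℂ (commutant A) = n := by
  let ev : commutant A →ₗ[ℂ] (Fin n → ℂ) :=
    LinearMap.applyₗ v ∘ₗ (Matrix.toLin' (R := ℂ)).toLinearMap ∘ₗ (commutant A).subtype
  have hinj : Function.Injective ev := by
    rw [← LinearMap.ker_eq_bot, LinearMap.ker_eq_bot']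
    intro X hX
    exact Subtype.ext (eq_zero_of_commute_of_mulVec_eq_zero hdet (mem_commutant.mp X.2) hX)
  have hsurj : Function.Surjective ev := by
    have hK := Matrix.mulVec_surjective_iff_isUnit.mpr
      ((Matrix.isUnit_iff_isUnit_det _).mpr (isUnit_iff_ne_zero.mpr hdet))
    intro w
    obtain ⟨c, rfl⟩ := hK w
    exact ⟨⟨_, mem_commutant.mpr (commute_sum_smul_pow A c).eq⟩, (krylov_mulVec A v c).symm⟩
  rw [(LinearEquiv.ofBijective ev ⟨hinj, hsurj⟩).finrank_eq, Module.finrank_fin_fun]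

end CyclicVectors

/-! ### Evaluation and restriction of regular functions. -/

namespace AffineVar

variable {X : Type*}

/-- Evaluation of regular functions at a point. -/
def evalAt (𝒪 : Subalgebra ℂ (X → ℂ)) (x : X) : 𝒪 →ₐ[ℂ] ℂ :=
  (Pi.evalAlgHom ℂ (fun _ : X => ℂ) x).comp 𝒪.val

@[simp] theorem evalAt_apply (𝒪 : Subalgebra ℂ (X → ℂ)) (x : X) (f : 𝒪) :
    evalAt 𝒪 x f = (f : X → ℂ) x := rfl

theorem ext_evalAt {𝒪 : Subalgebra ℂ (X → ℂ)} {f g : 𝒪} (h : ∀ x, evalAt 𝒪 x f = evalAt 𝒪 x g) :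
    f = g :=
  Subtype.ext (funext h)

/-- Restriction of regular functions to a subset. -/
def restrictReg (𝒪 : Subalgebra ℂ (X → ℂ)) (Z : Set X) : 𝒪 →ₐ[ℂ] coordRing 𝒪 Z :=
  ((restrictHom Z).comp 𝒪.val).codRestrict _ fun f => ⟨f, f.2, rfl⟩

theorem restrictReg_surjective (𝒪 : Subalgebra ℂ (X → ℂ)) (Z : Set X) :
    Function.Surjective (restrictReg 𝒪 Z) := by
  rintro ⟨_, f, hf, rfl⟩
  exact ⟨⟨f, hf⟩, rfl⟩

theorem mem_of_mem_adjoin {S : Set (X → ℂ)} (T : Subalgebra ℂ (Algebra.adjoin ℂ S))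
    (hT : ∀ f (hf : f ∈ S), ⟨f, Algebra.subset_adjoin hf⟩ ∈ T) (f : Algebra.adjoin ℂ S) : f ∈ T := by
  obtain ⟨f, hf⟩ := f
  induction hf using Algebra.adjoin_induction with
  | mem f hf => exact hT f hf
  | algebraMap r => exact T.algebraMap_mem r
  | add f g hf hg ihf ihg => exact T.add_mem ihf ihg
  | mul f g hf hg ihf ihg => exact T.mul_mem ihf ihg

theorem mem_of_restrictReg_mem {S : Set (X → ℂ)} (Z : Set X)
    (T : Subalgebra ℂ (coordRing (Algebra.adjoin ℂ S) Z))
    (hT : ∀ f (hf : f ∈ S), restrictReg _ Z ⟨f, Algebra.subset_adjoin hf⟩ ∈ T)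
    (r : coordRing (Algebra.adjoin ℂ S) Z) : r ∈ T := by
  obtain ⟨f, rfl⟩ := restrictReg_surjective _ Z r
  exact mem_of_mem_adjoin (T.comap (restrictReg _ Z)) hT f

end AffineVar

/-! ### From the dimension of the centralizer to that of the commutant. -/

open Matrix

theorem exists_det_add_smul_one_eq {n : ℕ} (hn : n ≠ 0) (M : Matrix (Fin n) (Fin n) ℂ) (r : ℂ) :
    ∃ x : ℂ, (M + x • (1 : Matrix (Fin n) (Fin n) ℂ)).det = r := by
  have hpos : 0 < (-M).charpoly.degree := by
    rw [Matrix.charpoly_degree_eq_dim, Fintype.card_fin]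
    exact_mod_cast Nat.pos_of_ne_zero hn
  obtain ⟨x, hx⟩ := IsAlgClosed.exists_root ((-M).charpoly - Polynomial.C r) (by
    rw [Polynomial.degree_sub_C hpos]
    exact hpos.ne')
  refine ⟨x, ?_⟩
  rw [Polynomial.IsRoot, Polynomial.eval_sub, Polynomial.eval_C, Matrix.eval_charpoly,
    sub_eq_zero] at hx
  rw [← hx, sub_neg_eq_add, add_comm, Matrix.smul_one_eq_diagonal]
  rfl

theorem linearMap_matrix_apply_eq_sum {n : ℕ} {M : Type*} [AddCommMonoid M] [Module ℂ M]
    (l : Matrix (Fin n) (Fin n) ℂ →ₗ[ℂ] M) (A : Matrix (Fin n) (Fin n) ℂ) :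
    l A = ∑ i, ∑ j, A i j • l (Matrix.single i j 1) := by
  conv_lhs => rw [Matrix.matrix_eq_sum_single A]
  simp only [map_sum]
  refine Finset.sum_congr rfl fun i _ => Finset.sum_congr rfl fun j _ => ?_
  rw [← map_smul, Matrix.smul_single, smul_eq_mul, mul_one]

namespace RepVar

variable {n : ℕ}

theorem entry_mem_slRegular (i j : Fin n) : (fun A : SL(n, ℂ) => A.1 i j) ∈ slRegular n :=
  Algebra.subset_adjoin ⟨i, j, rfl⟩

theorem linear_mem_slRegular (l : Matrix (Fin n) (Fin n) ℂ →ₗ[ℂ] ℂ) :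
    (fun A : SL(n, ℂ) => l A.1) ∈ slRegular n := by
  have h : (fun A : SL(n, ℂ) => l A.1) =
      ∑ i, ∑ j, l (Matrix.single i j 1) • fun A : SL(n, ℂ) => A.1 i j := by
    ext A
    rw [linearMap_matrix_apply_eq_sum]
    simp [mul_comm]
  rw [h]
  exact Subalgebra.sum_mem _ fun i _ => Subalgebra.sum_mem _ fun j _ =>
    Subalgebra.smul_mem _ (entry_mem_slRegular i j) _

/-- Subtracting the scalar `B o o` maps the centralizer finitely and onto `V'`, the matrices of the
commutant with vanishing `(o, o)` entry: the fibres are cut out by `det (Y + x) = 1`. So the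
centralizer has the dimension of `V'`, which is at least that of the commutant minus one. -/
theorem finrank_commutant_le_of_isRegularElement (hn : 1 ≤ n) {A : SL(n, ℂ)}
    (hA : IsRegularElement A) : Module.finrank ℂ (commutant A.1) ≤ n := by
  have hn0 : n ≠ 0 := by omega
  let o : Fin n := ⟨0, hn⟩
  let V' : Submodule ℂ (Matrix (Fin n) (Fin n) ℂ) :=
    commutant A.1 ⊓ LinearMap.ker (Matrix.entryLinearMap ℂ ℂ o o)
  have hV' : ∀ {Y}, Y ∈ V' ↔ A.1 * Y = Y * A.1 ∧ Y o o = 0 := by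
    intro Y
    simp [V', mem_commutant]
  let e := Module.finBasis ℂ V'
  -- the functionals giving the coordinates
  obtain ⟨P, hP⟩ := V'.subtype.exists_leftInverse_of_injective V'.ker_subtype
  have hP' : ∀ Y : V', P Y = Y := fun Y => LinearMap.congr_fun hP Y
  let sh : Matrix (Fin n) (Fin n) ℂ →ₗ[ℂ] Matrix (Fin n) (Fin n) ℂ :=
    LinearMap.id - (Matrix.entryLinearMap ℂ ℂ o o).smulRight 1
  have hsh : ∀ Y, sh Y = Y - Y o o • (1 : Matrix (Fin n) (Fin n) ℂ) := fun Y => rfl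
  let l : Fin (Module.finrank ℂ V') → Matrix (Fin n) (Fin n) ℂ →ₗ[ℂ] ℂ := fun k =>
    e.coord k ∘ₗ P ∘ₗ sh
  let Z : Set SL(n, ℂ) := Subgroup.centralizer {A}
  have hZ : ∀ {B : SL(n, ℂ)}, B ∈ Z ↔ A.1 * B.1 = B.1 * A.1 := by
    intro B
    simp only [Z, SetLike.mem_coe, Subgroup.mem_centralizer_singleton_iff]
    exact ⟨fun h => (congrArg Subtype.val h).symm, fun h => Subtype.ext h.symm⟩
  let R := AffineVar.coordRing (slRegular n) Z
  let ent : Fin n → Fin n → R := fun i j =>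
    AffineVar.restrictReg (slRegular n) Z ⟨_, entry_mem_slRegular i j⟩
  let y : Fin (Module.finrank ℂ V') → R := fun k =>
    AffineVar.restrictReg (slRegular n) Z ⟨_, linear_mem_slRegular (l k)⟩
  let g : MvPolynomial (Fin (Module.finrank ℂ V')) ℂ →ₐ[ℂ] R := MvPolynomial.aeval y
  have hdim : ringKrullDim R = Nat.card (Fin (Module.finrank ℂ V')) := by
    -- Injectivity of `g` is surjectivity onto `V'`: each point lifts, so a polynomial in the kernel
    -- vanishes everywhere.
    refine ringKrullDim_eq_card_of_injective_of_isIntegral g ?_ ?_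
    · rw [injective_iff_map_eq_zero]
      intro p hp
      apply MvPolynomial.funext
      intro c
      obtain ⟨x, hx⟩ := exists_det_add_smul_one_eq hn0 (∑ k, c k • (e k : Matrix (Fin n) (Fin n) ℂ)) 1
      set Y : V' := ∑ k, c k • e k with hY
      have hY' : (Y : Matrix (Fin n) (Fin n) ℂ) = ∑ k, c k • (e k : Matrix (Fin n) (Fin n) ℂ) := by
        simp [hY]
      rw [← hY'] at hx
      let B : SL(n, ℂ) := ⟨Y + x • (1 : Matrix (Fin n) (Fin n) ℂ), hx⟩
      have hB : B ∈ Z := by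
        rw [hZ]
        simp [B, mul_add, add_mul, (hV'.mp Y.2).1]
      have hyB : ∀ k, AffineVar.evalAt R ⟨B, hB⟩ (y k) = c k := by
        intro k
        change l k (Y + x • (1 : Matrix (Fin n) (Fin n) ℂ)) = c k
        have h1 : sh (Y + x • (1 : Matrix (Fin n) (Fin n) ℂ)) = Y := by
          rw [hsh]
          simp [(hV'.mp Y.2).2]
        simp only [l, LinearMap.comp_apply]
        rw [h1, hP', hY, Module.Basis.coord_apply, e.repr_sum_self]
      have h2 : AffineVar.evalAt R ⟨B, hB⟩ (g p) = 0 := by rw [hp, map_zero]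
      rw [← AlgHom.comp_apply, MvPolynomial.comp_aeval, funext hyB] at h2
      simpa [MvPolynomial.aeval_eq_eval] using h2
    · have : Nontrivial R := by
        refine ⟨0, 1, fun h => ?_⟩
        have := congrArg (AffineVar.evalAt R ⟨1, Subgroup.one_mem _⟩) h
        simp at this
      have hM : ∀ i j, ent i j - (if i = j then ent o o else 0) ∈ g.range := by
        intro i j
        have h1 : ent i j - (if i = j then ent o o else 0) =
            ∑ k, (e k : Matrix (Fin n) (Fin n) ℂ) i j • y k := by
          apply AffineVar.ext_evalAt
          rintro ⟨B, hB⟩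
          have hsB : sh B.1 ∈ V' := by
            rw [hV', hsh]
            have := hZ.mp hB
            simp [mul_sub, sub_mul, this]
          have h2 : (∑ k, l k B.1 • (e k : Matrix (Fin n) (Fin n) ℂ)) = sh B.1 := by
            have h3 := congrArg Subtype.val (e.sum_repr ⟨sh B.1, hsB⟩)
            have h4 : ∀ k, l k B.1 = e.repr ⟨sh B.1, hsB⟩ k := by
              intro k
              simp only [l, LinearMap.comp_apply]
              rw [hP' ⟨sh B.1, hsB⟩]
              rfl
            simp only [h4]
            rw [Submodule.coe_sum] at h3
            exact h3
          have h5 := congrFun (congrFun h2 i) j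
          rw [hsh] at h5
          simp only [map_sub, map_sum, map_smul]
          rw [Matrix.sum_apply] at h5
          change B.1 i j - AffineVar.evalAt R ⟨B, hB⟩ (if i = j then ent o o else 0) =
            ∑ k, (e k : Matrix (Fin n) (Fin n) ℂ) i j • l k B.1
          simp only [Matrix.smul_apply, smul_eq_mul, Matrix.sub_apply] at h5
          simp only [smul_eq_mul, mul_comm ((e _ : Matrix (Fin n) (Fin n) ℂ) i j), h5,
            Matrix.one_apply]
          split_ifs
          · simp; rfl
          · simp
        rw [h1]
        exact Subalgebra.sum_mem _ fun k _ => Subalgebra.smul_mem _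
          ((AlgHom.mem_range g).mpr ⟨MvPolynomial.X k, MvPolynomial.aeval_X _ _⟩) _
      have hoo : IsIntegral g.range (ent o o) := by
        refine isIntegral_of_det_add_smul_one_mem hn0 g.range
          (.of fun i j => ent i j - (if i = j then ent o o else 0)) hM _ ?_
        have h1 : (.of fun i j => ent i j - (if i = j then ent o o else 0)) +
            ent o o • (1 : Matrix (Fin n) (Fin n) R) = .of ent := by
          ext i j
          simp only [Matrix.add_apply, Matrix.smul_apply, Matrix.of_apply, Matrix.one_apply]
          split_ifs <;> simp
        have h2 : (Matrix.of ent).det = 1 := by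
          apply AffineVar.ext_evalAt
          rintro ⟨B, hB⟩
          rw [AlgHom.map_det, map_one]
          exact B.2
        rw [h1, h2]
        exact Subalgebra.one_mem _
      have hent : ∀ i j, IsIntegral g.range (ent i j) := by
        intro i j
        have h1 : ent i j = algebraMap g.range R ⟨_, hM i j⟩ + if i = j then ent o o else 0 :=
          (sub_add_cancel _ _).symm
        rw [h1]
        refine isIntegral_algebraMap.add ?_
        split_ifs
        · exact hoo
        · exact isIntegral_zero
      exact AffineVar.mem_of_restrictReg_mem Z ((integralClosure g.range R).restrictScalars ℂ)
        (by rintro _ ⟨i, j, rfl⟩; exact hent i j)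
  have hV : Module.finrank ℂ (commutant A.1) ≤ Module.finrank ℂ V' + 1 := by
    let T : V' × ℂ →ₗ[ℂ] commutant A.1 :=
      (Submodule.inclusion inf_le_left).coprod
        (LinearMap.toSpanSingleton ℂ (commutant A.1) ⟨1, mem_commutant.mpr (by simp)⟩)
    have hT : Function.Surjective T := by
      rintro ⟨Y, hY⟩
      have hY' := mem_commutant.mp hY
      refine ⟨⟨⟨sh Y, hV'.mpr ?_⟩, Y o o⟩, ?_⟩
      · simp [hsh, mul_sub, sub_mul, hY']
      · apply Subtype.ext
        simp [T, hsh]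
    have := LinearMap.finrank_le_finrank_of_surjective hT
    simpa using this
  have h := hA
  rw [IsRegularElement, AffineVar.dim] at h
  change ringKrullDim R = _ at h
  rw [hdim, Nat.card_eq_fintype_card, Fintype.card_fin] at h
  have h' : Module.finrank ℂ V' = n - 1 := by exact_mod_cast h
  omega

end RepVar

/-! ### Holomorphic matrix curves and normalization of determinants. -/

section EntrywiseDifferentiability

open Matrix

variable {n : ℕ}

/-- All entries of the matrix valued function `M` are differentiable at `z`. -/
def EntryDiff (M : ℂ → Matrix (Fin n) (Fin n) ℂ) (z : ℂ) : Prop :=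
  ∀ i j, DifferentiableAt ℂ (fun w => M w i j) z

namespace EntryDiff

variable {M N : ℂ → Matrix (Fin n) (Fin n) ℂ} {z : ℂ}

theorem const (A : Matrix (Fin n) (Fin n) ℂ) (z : ℂ) : EntryDiff (fun _ => A) z :=
  fun _ _ => differentiableAt_const _

theorem add (hM : EntryDiff M z) (hN : EntryDiff N z) : EntryDiff (fun w => M w + N w) z :=
  fun i j => (hM i j).add (hN i j)

theorem smul {f : ℂ → ℂ} (hf : DifferentiableAt ℂ f z) (hM : EntryDiff M z) :
    EntryDiff (fun w => f w • M w) z :=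
  fun i j => hf.mul (hM i j)

theorem mul (hM : EntryDiff M z) (hN : EntryDiff N z) : EntryDiff (fun w => M w * N w) z := by
  intro i j
  simp only [Matrix.mul_apply]
  exact DifferentiableAt.fun_sum fun k _ => (hM i k).mul (hN k j)

theorem pow (hM : EntryDiff M z) (k : ℕ) : EntryDiff (fun w => M w ^ k) z := by
  induction k with
  | zero => simpa using const 1 z
  | succ k ih => simpa only [pow_succ] using ih.mul hM

theorem sum {ι : Type*} (s : Finset ι) {M : ι → ℂ → Matrix (Fin n) (Fin n) ℂ}
    (hM : ∀ i ∈ s, EntryDiff (M i) z) : EntryDiff (fun w => ∑ i ∈ s, M i w) z := by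
  intro i j
  simp only [Matrix.sum_apply]
  exact DifferentiableAt.fun_sum fun k hk => hM k hk i j

theorem det (hM : EntryDiff M z) : DifferentiableAt ℂ (fun w => (M w).det) z := by
  simp only [Matrix.det_apply]
  refine DifferentiableAt.fun_sum fun τ _ => ?_
  refine DifferentiableAt.const_smul ?_ _
  exact DifferentiableAt.fun_finsetProd fun i _ => hM _ _

theorem adjugate (hM : EntryDiff M z) : EntryDiff (fun w => (M w).adjugate) z := by
  intro i j
  simp only [Matrix.adjugate_apply]
  refine det (M := fun w => (M w).updateRow j (Pi.single i 1)) fun k l => ?_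
  by_cases h : k = j
  · subst h
    simp only [Matrix.updateRow_self]
    exact differentiableAt_const _
  · simp only [Matrix.updateRow_ne h]
    exact hM k l

theorem congr (hM : EntryDiff M z) (h : ∀ᶠ w in nhds z, N w = M w) : EntryDiff N z :=
  fun i j => (hM i j).congr_of_eventuallyEq (h.mono fun w hw => by simp only [hw])

end EntryDiff

/-- A scalar multiple of `M` with determinant `1`, if `M` is invertible. -/
noncomputable def normalizeDet (M : Matrix (Fin n) (Fin n) ℂ) : Matrix (Fin n) (Fin n) ℂ :=
  Complex.exp (-Complex.log M.det / n) • M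

theorem det_normalizeDet (hn : n ≠ 0) {M : Matrix (Fin n) (Fin n) ℂ} (hM : M.det ≠ 0) :
    (normalizeDet M).det = 1 := by
  have hn' : (n : ℂ) ≠ 0 := Nat.cast_ne_zero.mpr hn
  rw [normalizeDet, Matrix.det_smul, Fintype.card_fin, ← Complex.exp_nat_mul,
    mul_div_cancel₀ _ hn', Complex.exp_neg, Complex.exp_log hM, inv_mul_cancel₀ hM]

theorem normalizeDet_of_det_eq_one {M : Matrix (Fin n) (Fin n) ℂ} (hM : M.det = 1) :
    normalizeDet M = M := by
  simp [normalizeDet, hM]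

theorem Commute.normalizeDet {M N : Matrix (Fin n) (Fin n) ℂ} (h : Commute M N) :
    Commute (normalizeDet M) (normalizeDet N) :=
  (h.smul_left _).smul_right _

theorem EntryDiff.normalizeDet {M : ℂ → Matrix (Fin n) (Fin n) ℂ} {z : ℂ} (hM : EntryDiff M z)
    (hz : (M z).det = 1) : EntryDiff (fun w => normalizeDet (M w)) z := by
  refine EntryDiff.smul ?_ hM
  refine ((hM.det.clog ?_).neg.div_const _).cexp
  rw [hz]
  exact Complex.one_mem_slitPlane

theorem EntryDiff.one_add_smul (A Y : Matrix (Fin n) (Fin n) ℂ) (z : ℂ) :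
    EntryDiff (fun w => A * (1 + w • Y)) z :=
  (const A z).mul ((const 1 z).add (smul differentiableAt_id (const Y z)))

theorem hasDerivAt_det_one_add_smul (Y : Matrix (Fin n) (Fin n) ℂ) :
    HasDerivAt (fun z : ℂ => (1 + z • Y).det) Y.trace 0 := by
  have h := (Matrix.det (1 + (Polynomial.X : Polynomial ℂ) • Y.map Polynomial.C)).hasDerivAt 0
  rw [Matrix.derivative_det_one_add_X_smul] at h
  convert! h using 2 with z
  rw [← Polynomial.coe_evalRingHom, RingHom.map_det]
  congr 1
  ext i j
  by_cases hij : i = j <;> simp [hij, mul_comm (Y _ _)]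

/-- When `Y` has trace zero the determinant is constant to first order, so the normalizing factor
contributes nothing to the derivative. -/
theorem hasDerivAt_normalizeDet {A Y : Matrix (Fin n) (Fin n) ℂ} (hA : A.det = 1)
    (hY : Y.trace = 0) (i j : Fin n) :
    HasDerivAt (fun z : ℂ => normalizeDet (A * (1 + z • Y)) i j) ((A * Y) i j) 0 := by
  have hdet : HasDerivAt (fun z : ℂ => (A * (1 + z • Y)).det) 0 0 := by
    simpa [Matrix.det_mul, hA, hY] using hasDerivAt_det_one_add_smul Y
  have hlin : HasDerivAt (fun z : ℂ => (A * (1 + z • Y)) i j) ((A * Y) i j) 0 := by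
    simp only [mul_add, mul_one, mul_smul_comm, Matrix.add_apply, Matrix.smul_apply, smul_eq_mul]
    simpa using ((hasDerivAt_id (0 : ℂ)).mul_const ((A * Y) i j)).const_add (A i j)
  have h0 : (A * (1 + (0 : ℂ) • Y)).det = 1 := by simp [hA]
  have hexp := ((hdet.clog (by rw [h0]; exact Complex.one_mem_slitPlane)).neg.div_const (n : ℂ)).cexp
  have h := hexp.mul hlin
  convert! h using 1
  simp [hA]

end EntrywiseDifferentiability

/-! ### Representations as commuting pairs, and curves of representations. -/

namespace RepVar

open Matrix

variable {n : ℕ} (b : Module.Basis (Fin 2) ℤ (ℤ × ℤ))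

/-- The image of the first basis vector. -/
noncomputable def matA (σ : Rep n (Multiplicative (ℤ × ℤ))) : Matrix (Fin n) (Fin n) ℂ :=
  (σ (Multiplicative.ofAdd (b 0))).1

/-- The image of the second basis vector. -/
noncomputable def matB (σ : Rep n (Multiplicative (ℤ × ℤ))) : Matrix (Fin n) (Fin n) ℂ :=
  (σ (Multiplicative.ofAdd (b 1))).1

theorem det_matA (σ : Rep n (Multiplicative (ℤ × ℤ))) : (matA b σ).det = 1 :=
  (σ (Multiplicative.ofAdd (b 0))).2

theorem det_matB (σ : Rep n (Multiplicative (ℤ × ℤ))) : (matB b σ).det = 1 :=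
  (σ (Multiplicative.ofAdd (b 1))).2

theorem commute_matA_matB (σ : Rep n (Multiplicative (ℤ × ℤ))) :
    Commute (matA b σ) (matB b σ) := by
  have h : σ (Multiplicative.ofAdd (b 0)) * σ (Multiplicative.ofAdd (b 1)) =
      σ (Multiplicative.ofAdd (b 1)) * σ (Multiplicative.ofAdd (b 0)) := by
    rw [← map_mul σ, ← map_mul σ, mul_comm]
  exact congrArg Subtype.val h

theorem eq_zpow_mul_zpow (γ : Multiplicative (ℤ × ℤ)) :
    γ = Multiplicative.ofAdd (b 0) ^ b.repr γ.toAdd 0 *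
      Multiplicative.ofAdd (b 1) ^ b.repr γ.toAdd 1 := by
  apply Multiplicative.toAdd.injective
  rw [toAdd_mul, toAdd_zpow, toAdd_zpow, toAdd_ofAdd, toAdd_ofAdd]
  conv_lhs => rw [← b.sum_repr γ.toAdd, Fin.sum_univ_two]

/-- The representation attached to a pair of commuting matrices. -/
noncomputable def mkRep (A B : SL(n, ℂ)) (h : Commute A B) : Rep n (Multiplicative (ℤ × ℤ)) where
  toFun γ := A ^ b.repr γ.toAdd 0 * B ^ b.repr γ.toAdd 1
  map_one' := by simp
  map_mul' γ δ := by
    have h' := (h.zpow_zpow (b.repr δ.toAdd 0) (b.repr γ.toAdd 1)).eq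
    simp only [toAdd_mul, map_add, Finsupp.add_apply, _root_.zpow_add]
    rw [mul_assoc, mul_assoc, ← mul_assoc _ (B ^ _), h', mul_assoc]

theorem matA_mkRep (A B : SL(n, ℂ)) (h : Commute A B) : matA b (mkRep b A B h) = A.1 := by
  simp [matA, mkRep]

theorem matB_mkRep (A B : SL(n, ℂ)) (h : Commute A B) : matB b (mkRep b A B h) = B.1 := by
  simp [matB, mkRep]

theorem rep_ext {σ τ : Rep n (Multiplicative (ℤ × ℤ))} (hA : matA b σ = matA b τ)
    (hB : matB b σ = matB b τ) : σ = τ := by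
  refine MonoidHom.ext fun γ => ?_
  rw [eq_zpow_mul_zpow b γ]
  simp only [map_mul, map_zpow]
  rw [show σ (Multiplicative.ofAdd (b 0)) = τ (Multiplicative.ofAdd (b 0)) from Subtype.ext hA,
    show σ (Multiplicative.ofAdd (b 1)) = τ (Multiplicative.ofAdd (b 1)) from Subtype.ext hB]

/-- The matrix entries of the images of the basis vectors. -/
def entryFns (n : ℕ) : Set (Rep n (Multiplicative (ℤ × ℤ)) → ℂ) :=
  Set.range (fun (p : Fin n × Fin n) σ => matA b σ p.1 p.2) ∪
    Set.range (fun (p : Fin n × Fin n) σ => matB b σ p.1 p.2)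

/-- The `γ` whose matrix entries are polynomials in those of the two generators form a subgroup,
inverses being adjugates. -/
theorem repRegular_eq_adjoin : repRegular n (Multiplicative (ℤ × ℤ)) = Algebra.adjoin ℂ (entryFns b n) := by
  apply le_antisymm
  · refine Algebra.adjoin_le ?_
    let H : Subgroup (Multiplicative (ℤ × ℤ)) :=
      { carrier := {γ | ∃ M : Matrix (Fin n) (Fin n) (Algebra.adjoin ℂ (entryFns b n)),
          ∀ σ, M.map (AffineVar.evalAt _ σ) = (σ γ).1}
        one_mem' := ⟨1, fun σ => by rw [Matrix.map_one _ (map_zero _) (map_one _), map_one]; rfl⟩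
        mul_mem' := by
          rintro γ δ ⟨M, hM⟩ ⟨N, hN⟩
          exact ⟨M * N, fun σ => by rw [Matrix.map_mul, hM, hN, map_mul]; rfl⟩
        inv_mem' := by
          rintro γ ⟨M, hM⟩
          refine ⟨M.adjugate, fun σ => ?_⟩
          have h := (AffineVar.evalAt (Algebra.adjoin ℂ (entryFns b n)) σ).map_adjugate M
          rw [AlgHom.mapMatrix_apply, AlgHom.mapMatrix_apply, hM] at h
          rw [h, map_inv, Matrix.SpecialLinearGroup.coe_inv] }
    have h0 : Multiplicative.ofAdd (b 0) ∈ H :=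
      ⟨.of fun i j => ⟨_, Algebra.subset_adjoin (Or.inl ⟨(i, j), rfl⟩)⟩, fun σ => rfl⟩
    have h1 : Multiplicative.ofAdd (b 1) ∈ H :=
      ⟨.of fun i j => ⟨_, Algebra.subset_adjoin (Or.inr ⟨(i, j), rfl⟩)⟩, fun σ => rfl⟩
    rintro _ ⟨γ, i, j, rfl⟩
    have hγ : γ ∈ H := by
      rw [eq_zpow_mul_zpow b γ]
      exact H.mul_mem (H.zpow_mem h0 _) (H.zpow_mem h1 _)
    obtain ⟨M, hM⟩ := hγ
    convert! (M i j).2 using 1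
    ext σ
    rw [← hM]
    rfl
  · refine Algebra.adjoin_mono ?_
    rintro _ (⟨⟨i, j⟩, rfl⟩ | ⟨⟨i, j⟩, rfl⟩)
    · exact ⟨_, i, j, rfl⟩
    · exact ⟨_, i, j, rfl⟩

theorem differentiableAt_of_entryDiff {γ : ℂ → Rep n (Multiplicative (ℤ × ℤ))} {z : ℂ}
    (hA : EntryDiff (fun w => matA b (γ w)) z) (hB : EntryDiff (fun w => matB b (γ w)) z)
    {f : Rep n (Multiplicative (ℤ × ℤ)) → ℂ} (hf : f ∈ repRegular n (Multiplicative (ℤ × ℤ))) :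
    DifferentiableAt ℂ (fun w => f (γ w)) z := by
  rw [repRegular_eq_adjoin b] at hf
  induction hf using Algebra.adjoin_induction with
  | mem f hf =>
    rcases hf with ⟨⟨i, j⟩, rfl⟩ | ⟨⟨i, j⟩, rfl⟩
    · exact hA i j
    · exact hB i j
  | algebraMap r => exact differentiableAt_const _
  | add f g hf hg ihf ihg => exact ihf.add ihg
  | mul f g hf hg ihf ihg => exact ihf.mul ihg

theorem exists_curve (hn : n ≠ 0) (σ : Rep n (Multiplicative (ℤ × ℤ)))
    {M N : ℂ → Matrix (Fin n) (Fin n) ℂ} (hM : EntryDiff M 0) (hN : EntryDiff N 0)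
    (hMN : ∀ z, Commute (M z) (N z)) (hM0 : M 0 = matA b σ) (hN0 : N 0 = matB b σ) :
    ∃ γ : ℂ → Rep n (Multiplicative (ℤ × ℤ)), γ 0 = σ ∧
      (∀ᶠ z in nhds 0, matA b (γ z) = normalizeDet (M z) ∧ matB b (γ z) = normalizeDet (N z)) ∧
      EntryDiff (fun z => matA b (γ z)) 0 ∧ EntryDiff (fun z => matB b (γ z)) 0 := by
  classical
  have hMd : (M 0).det = 1 := by rw [hM0, det_matA]
  have hNd : (N 0).det = 1 := by rw [hN0, det_matB]
  let γ : ℂ → Rep n (Multiplicative (ℤ × ℤ)) := fun z =>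
    if h : (M z).det ≠ 0 ∧ (N z).det ≠ 0 then
      mkRep b ⟨_, det_normalizeDet hn h.1⟩ ⟨_, det_normalizeDet hn h.2⟩
        (Subtype.ext (hMN z).normalizeDet.eq)
    else 1
  have hγ : ∀ z, (M z).det ≠ 0 → (N z).det ≠ 0 →
      matA b (γ z) = normalizeDet (M z) ∧ matB b (γ z) = normalizeDet (N z) := by
    intro z h1 h2
    simp only [γ, dif_pos (And.intro h1 h2)]
    exact ⟨matA_mkRep b _ _ _, matB_mkRep b _ _ _⟩
  have hev : ∀ᶠ z in nhds 0,
      matA b (γ z) = normalizeDet (M z) ∧ matB b (γ z) = normalizeDet (N z) := by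
    have h1 : ∀ᶠ z in nhds (0 : ℂ), (M z).det ≠ 0 :=
      hM.det.continuousAt.eventually_ne (by rw [hMd]; exact one_ne_zero)
    have h2 : ∀ᶠ z in nhds (0 : ℂ), (N z).det ≠ 0 :=
      hN.det.continuousAt.eventually_ne (by rw [hNd]; exact one_ne_zero)
    filter_upwards [h1, h2] with z h1 h2 using hγ z h1 h2
  refine ⟨γ, ?_, hev, (hM.normalizeDet hMd).congr (hev.mono fun z hz => hz.1),
    (hN.normalizeDet hNd).congr (hev.mono fun z hz => hz.2)⟩
  obtain ⟨h1, h2⟩ := hev.self_of_nhds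
  refine rep_ext b ?_ ?_
  · rw [h1, normalizeDet_of_det_eq_one hMd, hM0]
  · rw [h2, normalizeDet_of_det_eq_one hNd, hN0]

/-- The tangent vector of a differentiable curve. -/
noncomputable def velocity (γ : ℂ → Rep n (Multiplicative (ℤ × ℤ)))
    (hA : EntryDiff (fun w => matA b (γ w)) 0) (hB : EntryDiff (fun w => matB b (γ w)) 0) :
    AffineVar.tangentSpace (repRegular n (Multiplicative (ℤ × ℤ))) (γ 0) :=
  ⟨{ toFun := fun f => deriv (fun z => (f : Rep n (Multiplicative (ℤ × ℤ)) → ℂ) (γ z)) 0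
     map_add' := fun f g => deriv_fun_add (differentiableAt_of_entryDiff b hA hB f.2)
       (differentiableAt_of_entryDiff b hA hB g.2)
     map_smul' := fun c f => deriv_const_smul c (differentiableAt_of_entryDiff b hA hB f.2) },
   fun f g => by
     have h := deriv_fun_mul (differentiableAt_of_entryDiff b hA hB f.2)
       (differentiableAt_of_entryDiff b hA hB g.2)
     refine h.trans ?_
     simp only [LinearMap.coe_mk, AddHom.coe_mk]
     ring⟩

end RepVar

/-! ### Zariski closures, irreducibility and local dimension. -/

namespace AffineVar

variable {X : Type*} {𝒪 : Subalgebra ℂ (X → ℂ)}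

theorem isClosed_zariski_iff {Z : Set X} :
    @IsClosed X (zariski 𝒪) Z ↔ ∃ S : Set (X → ℂ), S ⊆ 𝒪 ∧ Z = zeros S := by
  rw [← @isOpen_compl_iff X Z (zariski 𝒪)]
  change Zᶜᶜ ∈ _ ↔ _
  rw [compl_compl]
  rfl

theorem mem_closure_zariski_iff {Z : Set X} {x : X} :
    x ∈ @closure X (zariski 𝒪) Z ↔ ∀ f ∈ 𝒪, (∀ z ∈ Z, f z = 0) → f x = 0 := by
  let _ := zariski 𝒪
  constructor
  · intro hx f hf hfZ
    have hcl : IsClosed (zeros {f}) := isClosed_zariski_iff.mpr ⟨{f}, by simpa using hf, rfl⟩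
    have hsub : Z ⊆ zeros {f} := fun z hz g hg => by
      rw [Set.mem_singleton_iff.mp hg]
      exact hfZ z hz
    exact closure_minimal hsub hcl hx f rfl
  · intro h
    obtain ⟨S, hS, hZ⟩ := isClosed_zariski_iff.mp (isClosed_closure (s := Z))
    rw [hZ]
    intro f hf
    refine h f (hS hf) fun z hz => ?_
    have hz' := subset_closure hz
    rw [hZ] at hz'
    exact hz' f hf

/-- Whenever a product of two regular functions vanishes on `W`, so does one of the factors. -/
def IsPrimeSet (𝒪 : Subalgebra ℂ (X → ℂ)) (W : Set X) : Prop :=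
  ∀ f ∈ 𝒪, ∀ g ∈ 𝒪, (∀ x ∈ W, f x * g x = 0) → (∀ x ∈ W, f x = 0) ∨ ∀ x ∈ W, g x = 0

theorem IsPrimeSet.isIrreducible_closure {W : Set X} (hW : IsPrimeSet 𝒪 W) (hne : W.Nonempty) :
    @IsIrreducible X (zariski 𝒪) (@closure X (zariski 𝒪) W) := by
  let _ := zariski 𝒪
  refine IsIrreducible.closure ⟨hne, ?_⟩
  rw [isPreirreducible_iff_isClosed_union_isClosed]
  intro Z₁ Z₂ h₁ h₂ hsub
  obtain ⟨S, hS, rfl⟩ := isClosed_zariski_iff.mp h₁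
  obtain ⟨T, hT, rfl⟩ := isClosed_zariski_iff.mp h₂
  by_contra! hcon
  obtain ⟨⟨x, hxW, hx⟩, y, hyW, hy⟩ := hcon.imp Set.not_subset.mp Set.not_subset.mp
  simp only [zeros, Set.mem_ofPred_eq, not_forall] at hx hy
  obtain ⟨f, hf, hfx⟩ := hx
  obtain ⟨g, hg, hgy⟩ := hy
  rcases hW f (hS hf) g (hT hg) (fun w hw => by
    rcases hsub hw with h | h
    · rw [h f hf, zero_mul]
    · rw [h g hg, mul_zero]) with h | h
  · exact hfx (h x hxW)
  · exact hgy (h y hyW)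

theorem IsPrimeSet.noZeroDivisors {W : Set X} (hW : IsPrimeSet 𝒪 W) :
    NoZeroDivisors (coordRing 𝒪 (@closure X (zariski 𝒪) W)) := by
  let _ := zariski 𝒪
  refine ⟨fun {a b} hab => ?_⟩
  obtain ⟨f, rfl⟩ := restrictReg_surjective _ _ a
  obtain ⟨g, rfl⟩ := restrictReg_surjective _ _ b
  have key : ∀ f : 𝒪, (∀ x ∈ W, (f : X → ℂ) x = 0) → restrictReg 𝒪 (closure W) f = 0 := by
    intro f hf
    apply ext_evalAt
    rintro ⟨x, hx⟩
    exact mem_closure_zariski_iff.mp hx f f.2 hf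
  refine (hW f f.2 g g.2 fun x hx => ?_).imp (key f) (key g)
  exact congrArg (evalAt _ ⟨x, subset_closure hx⟩) hab

/-- A point `x` lies on a unique irreducible component, the closure of `W`, if a basic open
neighbourhood of `x` is contained in that closure. -/
theorem IsPrimeSet.mem_components_iff {W : Set X} (hW : IsPrimeSet 𝒪 W) {x : X} {h : X → ℂ}
    (hh : h ∈ 𝒪) (hx : h x ≠ 0) (hsub : ∀ y, h y ≠ 0 → y ∈ @closure X (zariski 𝒪) W) (C : Set X) :
    (C ∈ components 𝒪 ∧ x ∈ C) ↔ C = @closure X (zariski 𝒪) W := by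
  let _ := zariski 𝒪
  have hxW : x ∈ closure W := hsub x hx
  have hirr : IsIrreducible (closure W) :=
    hW.isIrreducible_closure (closure_nonempty_iff.mp ⟨x, hxW⟩)
  have key : ∀ Z : Set X, IsIrreducible Z → x ∈ Z → Z ⊆ closure W := by
    intro Z hZ hxZ
    have hcl : IsClosed (zeros {h}) := isClosed_zariski_iff.mpr ⟨{h}, by simpa using hh, rfl⟩
    refine (isPreirreducible_iff_isClosed_union_isClosed.mp hZ.2 (zeros {h}) (closure W) hcl
      isClosed_closure fun y _ => ?_).resolve_left fun hZh => hx (hZh hxZ h rfl)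
    by_cases hy : h y = 0
    · exact Or.inl fun g hg => by rw [Set.mem_singleton_iff.mp hg]; exact hy
    · exact Or.inr (hsub y hy)
  constructor
  · rintro ⟨hC, hxC⟩
    exact (key C hC.1 hxC).antisymm (hC.2 hirr (key C hC.1 hxC))
  · rintro rfl
    exact ⟨⟨hirr, fun Z hZ hle => key Z hZ (hle hxW)⟩, hxW⟩

theorem localDim_eq_of_components {x : X} {C : Set X}
    (hC : ∀ Z, (Z ∈ components 𝒪 ∧ x ∈ Z) ↔ Z = C) : localDim 𝒪 x = dim 𝒪 C := by
  have h : {d | ∃ C ∈ components 𝒪, x ∈ C ∧ dim 𝒪 C = d} = {dim 𝒪 C} := by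
    ext d
    constructor
    · rintro ⟨Z, hZ, hxZ, rfl⟩
      rw [(hC Z).mp ⟨hZ, hxZ⟩]
      rfl
    · rintro rfl
      obtain ⟨h1, h2⟩ := (hC C).mpr rfl
      exact ⟨C, h1, h2, rfl⟩
  rw [localDim, h, sSup_singleton]

end AffineVar

/-! ### Perturbation to distinct eigenvalues and diagonalization. -/

section Diagonalization

open Matrix Polynomial

variable {n : ℕ}

theorem exists_eq_conj_diagonal {S : Matrix (Fin n) (Fin n) ℂ} (hS : S.charpoly.Separable) :
    ∃ (P : Matrix (Fin n) (Fin n) ℂ) (d : Fin n → ℂ), P.det ≠ 0 ∧ S = P * diagonal d * P⁻¹ := by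
  have hcard : S.charpoly.roots.toFinset.card = n := by
    rw [Multiset.toFinset_card_of_nodup (nodup_roots hS), IsAlgClosed.card_roots_eq_natDegree,
      charpoly_natDegree_eq_dim, Fintype.card_fin]
  let r := (S.charpoly.roots.toFinset.equivFinOfCardEq hcard).symm
  let d : Fin n → ℂ := fun i => r i
  have hd : Function.Injective d := Subtype.val_injective.comp r.injective
  have hev : ∀ i, ∃ v, Module.End.HasEigenvector (Matrix.toLin' S) (d i) v := by
    intro i
    have h1 : (toLin' S).charpoly.IsRoot (d i) := by
      rw [charpoly_toLin']
      exact isRoot_of_mem_roots (Multiset.mem_toFinset.mp (r i).2)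
    exact ((Module.End.hasEigenvalue_iff_isRoot_charpoly _ _).mpr h1).exists_hasEigenvector
  choose v hv using hev
  have hli := Module.End.eigenvectors_linearIndependent' (toLin' S) d hd v hv
  let P : Matrix (Fin n) (Fin n) ℂ := .of fun i j => v j i
  have hP : IsUnit P := Matrix.linearIndependent_cols_iff_isUnit.mp hli
  have hPdet : IsUnit P.det := (Matrix.isUnit_iff_isUnit_det _).mp hP
  refine ⟨P, d, hPdet.ne_zero, ?_⟩
  have h : S * P = P * diagonal d := by
    ext i j
    rw [mul_diagonal]
    have h1 := congrFun (hv j).apply_eq_smul i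
    rw [toLin'_apply] at h1
    simpa [P, mul_apply, mulVec, dotProduct, mul_comm] using h1
  rw [← h, mul_assoc, mul_nonsing_inv _ hPdet, mul_one]

theorem eventually_separable_charpoly_add_smul (A : Matrix (Fin n) (Fin n) ℂ) :
    ∃ D : Matrix (Fin n) (Fin n) ℂ,
      ∀ᶠ z in nhdsWithin (0 : ℂ) {0}ᶜ, (A + z • D).charpoly.Separable := by
  let d : Fin n → ℂ := fun i => (i : ℕ)
  have hd : Function.Injective d := fun i j h => Fin.ext (Nat.cast_injective h)
  -- The line `A + z D` reaches at `z = 1` the diagonal matrix with distinct entries `0, …, n - 1`.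
  refine ⟨diagonal d - A, ?_⟩
  let M : Matrix (Fin n) (Fin n) ℂ[X] := A.map C + (X : ℂ[X]) • (diagonal d - A).map C
  have hM : ∀ z : ℂ, M.map (evalRingHom z) = A + z • (diagonal d - A) := by
    intro z
    ext i j
    simp [M]
  -- The degrees are fixed at `n` and `n - 1` so that the resultant commutes with evaluation at `z`.
  -- Being nonzero at `1`, `q` has finitely many roots.
  let q : ℂ[X] := resultant M.charpoly (derivative M.charpoly) n (n - 1)
  have hq : ∀ z : ℂ, q.eval z ≠ 0 ↔ (A + z • (diagonal d - A)).charpoly.Separable := by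
    intro z
    have h1 : q.eval z = resultant (A + z • (diagonal d - A)).charpoly
        (derivative (A + z • (diagonal d - A)).charpoly) := by
      rw [natDegree_derivative, charpoly_natDegree_eq_dim, Fintype.card_fin, ← hM, charpoly_map,
        derivative_map, resultant_map_map, coe_evalRingHom]
    rw [h1, Ne, resultant_eq_zero_iff, not_and, not_not, Polynomial.Separable]
    have h2 : (A + z • (diagonal d - A)).charpoly ≠ 0 := (charpoly_monic _).ne_zero
    simp [h2]
  have hq0 : q ≠ 0 := by
    intro h
    refine (hq 1).mpr ?_ (by rw [h, eval_zero])
    rw [one_smul, add_sub_cancel, charpoly_diagonal]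
    exact separable_prod_X_sub_C_iff.mpr hd
  have hfin : {z | q.IsRoot z}.Finite := q.finite_setOfPred_isRoot hq0
  have hopen : ∀ᶠ z in nhdsWithin (0 : ℂ) {0}ᶜ, z ∉ {z | q.IsRoot z} \ {0} := by
    refine nhdsWithin_le_nhds ?_
    exact (hfin.subset Set.sdiff_subset).isClosed.isOpen_compl.mem_nhds (by simp)
  filter_upwards [hopen, self_mem_nhdsWithin] with z hz hz0
  exact (hq z).mp fun h => hz ⟨h, hz0⟩

theorem sum_smul_conj_pow {P : Matrix (Fin n) (Fin n) ℂ} (hP : P.det ≠ 0) (d c : Fin n → ℂ) :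
    ∑ i, c i • (P * diagonal d * P⁻¹) ^ (i : ℕ) =
      P * diagonal (∑ i, c i • d ^ (i : ℕ)) * P⁻¹ := by
  have hP' : IsUnit P.det := isUnit_iff_ne_zero.mpr hP
  have hpow : ∀ k : ℕ, (P * diagonal d * P⁻¹) ^ k = P * diagonal (d ^ k) * P⁻¹ := by
    intro k
    induction k with
    | zero => simp [mul_nonsing_inv _ hP', show diagonal (1 : Fin n → ℂ) = 1 from diagonal_one]
    | succ k ih =>
      rw [pow_succ, ih, pow_succ, show diagonal (d ^ k * d) = diagonal (d ^ k) * diagonal d from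
        (diagonal_mul_diagonal _ _).symm]
      simp only [mul_assoc, nonsing_inv_mul_cancel_left _ _ hP']
  have hsum : diagonal (∑ i, c i • d ^ (i : ℕ)) = ∑ i, c i • diagonal (d ^ (i : ℕ)) := by
    ext i j
    by_cases hij : i = j
    · subst hij; simp [Matrix.sum_apply]
    · simp [Matrix.sum_apply, hij]
  simp only [hpow, hsum, Matrix.mul_sum, Matrix.sum_mul, mul_smul_comm, smul_mul_assoc]

theorem det_conj_diagonal {P : Matrix (Fin n) (Fin n) ℂ} (hP : P.det ≠ 0) (d : Fin n → ℂ) :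
    (P * diagonal d * P⁻¹).det = ∏ i, d i := by
  rw [det_mul, det_mul, mul_right_comm, ← det_mul, mul_nonsing_inv _ (isUnit_iff_ne_zero.mpr hP),
    det_one, one_mul, det_diagonal]

theorem exists_exp_eq_of_prod_eq_one (hn : n ≠ 0) {d : Fin n → ℂ} (hd : ∏ i, d i = 1) :
    ∃ e : Fin n → ℂ, ∑ i, e i = 0 ∧ d = fun i => Complex.exp (e i) := by
  obtain ⟨m, rfl⟩ := Nat.exists_eq_succ_of_ne_zero hn
  have hne : ∀ i, d i ≠ 0 := by
    intro i
    have := Finset.prod_ne_zero_iff.mp (hd.trans_ne one_ne_zero)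
    exact this i (Finset.mem_univ i)
  rw [Fin.prod_univ_succ] at hd
  -- Principal logarithms need only sum to a multiple of `2πi`; defining the first exponent from the
  -- others makes the sum exactly `0`.
  refine ⟨Fin.cons (-∑ i : Fin m, Complex.log (d i.succ)) fun i => Complex.log (d i.succ), ?_, ?_⟩
  · simp [Fin.sum_univ_succ]
  · ext i
    refine Fin.cases ?_ (fun i => ?_) i
    · simp only [Fin.cons_zero, Complex.exp_neg, Complex.exp_sum, Complex.exp_log (hne _)]
      exact eq_inv_of_mul_eq_one_left hd
    · simp [Complex.exp_log (hne _)]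

end Diagonalization

/-! ### The irreducible set of diagonalizable representations and its closure. -/

namespace RepVar

open Matrix

variable {n : ℕ} (b : Module.Basis (Fin 2) ℤ (ℤ × ℤ))

/-- The matrix `P exp(diag e) P⁻¹`. -/
noncomputable def expConj (P : Matrix (Fin n) (Fin n) ℂ) (e : Fin n → ℂ) :
    Matrix (Fin n) (Fin n) ℂ :=
  P * diagonal (fun i => Complex.exp (e i)) * P⁻¹

theorem det_expConj {P : Matrix (Fin n) (Fin n) ℂ} (hP : P.det ≠ 0) {e : Fin n → ℂ}
    (he : ∑ i, e i = 0) : (expConj P e).det = 1 := by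
  rw [expConj, det_conj_diagonal hP, ← Complex.exp_sum, he, Complex.exp_zero]

theorem commute_expConj {P : Matrix (Fin n) (Fin n) ℂ} (hP : P.det ≠ 0) (e f : Fin n → ℂ) :
    Commute (expConj P e) (expConj P f) := by
  have hP' : IsUnit P.det := isUnit_iff_ne_zero.mpr hP
  rw [Commute, SemiconjBy, expConj, expConj]
  simp only [mul_assoc, nonsing_inv_mul_cancel_left _ _ hP']
  simp only [← mul_assoc (diagonal _) (diagonal _), diagonal_mul_diagonal, mul_comm]

/-- The representations by simultaneously diagonalizable matrices. -/
def diagonalizableReps (n : ℕ) : Set (Rep n (Multiplicative (ℤ × ℤ))) :=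
  {σ | ∃ (P : Matrix (Fin n) (Fin n) ℂ) (e f : Fin n → ℂ), P.det ≠ 0 ∧ ∑ i, e i = 0 ∧
    ∑ i, f i = 0 ∧ matA b σ = expConj P e ∧ matB b σ = expConj P f}

theorem entryDiff_expConj_line {P Q : Matrix (Fin n) (Fin n) ℂ} {e e' : Fin n → ℂ} {z : ℂ}
    (hz : (P + z • Q).det ≠ 0) :
    EntryDiff (fun w => expConj (P + w • Q) (e + w • e')) z := by
  have hlin : EntryDiff (fun w => P + w • Q) z :=
    (EntryDiff.const P z).add (EntryDiff.smul differentiableAt_id (EntryDiff.const Q z))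
  have hdiag : EntryDiff (fun w => diagonal fun i => Complex.exp ((e + w • e') i)) z := by
    intro i j
    by_cases hij : i = j
    · subst hij
      simp only [diagonal_apply_eq, Pi.add_apply, Pi.smul_apply, smul_eq_mul]
      fun_prop
    · simp only [diagonal_apply_ne _ hij]
      exact differentiableAt_const _
  have hinv : EntryDiff (fun w => (P + w • Q)⁻¹) z := by
    simp only [Matrix.inv_def, Ring.inverse_eq_inv']
    exact EntryDiff.smul (hlin.det.inv hz) hlin.adjugate
  exact (hlin.mul hdiag).mul hinv

theorem finite_setOf_det_add_smul_eq_zero {P : Matrix (Fin n) (Fin n) ℂ} (hP : P.det ≠ 0)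
    (Q : Matrix (Fin n) (Fin n) ℂ) : {z : ℂ | (P + z • Q).det = 0}.Finite := by
  let q : Polynomial ℂ :=
    (P.map Polynomial.C + (Polynomial.X : Polynomial ℂ) • Q.map Polynomial.C).det
  have hq : ∀ z, q.eval z = (P + z • Q).det := by
    intro z
    rw [← Polynomial.coe_evalRingHom, RingHom.map_det]
    congr 1
    ext i j
    simp [mul_comm z]
  have hq0 : q ≠ 0 := by
    intro h
    apply hP
    have := hq 0
    rw [h, Polynomial.eval_zero, zero_smul, add_zero] at this
    exact this.symm
  refine (q.finite_setOfPred_isRoot hq0).subset fun z hz => ?_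
  exact (hq z).trans hz

/-- The parameters `(P, e, f)` of two points are interpolated linearly; exponentials turn `det = 1`
into a linear condition preserved on the way. The line minus the finitely many zeros of `det P` is
connected, so the identity theorem applies to the product of two regular functions. -/
theorem isPrimeSet_diagonalizableReps :
    AffineVar.IsPrimeSet (repRegular n (Multiplicative (ℤ × ℤ))) (diagonalizableReps b n) := by
  classical
  intro f hf g hg hfg
  by_contra! hcon
  obtain ⟨⟨σ, ⟨P, e₁, e₂, hP, he₁, he₂, hσA, hσB⟩, hfσ⟩,
    τ, ⟨P', e₁', e₂', hP', he₁', he₂', hτA, hτB⟩, hgτ⟩ := hcon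
  have hsum : ∀ {e e' : Fin n → ℂ}, ∑ i, e i = 0 → ∑ i, e' i = 0 → ∀ z : ℂ,
      ∑ i, (e + z • (e' - e)) i = 0 := by
    intro e e' he he' z
    simp only [Pi.add_apply, Pi.smul_apply, Pi.sub_apply, smul_eq_mul, Finset.sum_add_distrib,
      ← Finset.mul_sum, Finset.sum_sub_distrib, he, he', sub_zero, mul_zero, add_zero]
  let Ω : Set ℂ := {z | (P + z • (P' - P)).det = 0}ᶜ
  let γ : ℂ → Rep n (Multiplicative (ℤ × ℤ)) := fun z =>
    if h : z ∈ Ω then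
      mkRep b ⟨_, det_expConj h (hsum he₁ he₁' z)⟩ ⟨_, det_expConj h (hsum he₂ he₂' z)⟩
        (Subtype.ext (commute_expConj h _ _).eq)
    else 1
  have hγ : ∀ z ∈ Ω, matA b (γ z) = expConj (P + z • (P' - P)) (e₁ + z • (e₁' - e₁)) ∧
      matB b (γ z) = expConj (P + z • (P' - P)) (e₂ + z • (e₂' - e₂)) := by
    intro z hz
    simp only [γ, dif_pos hz]
    exact ⟨matA_mkRep b _ _ _, matB_mkRep b _ _ _⟩
  have hfin := finite_setOf_det_add_smul_eq_zero hP (P' - P)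
  have hΩ : IsOpen Ω := hfin.isClosed.isOpen_compl
  have hΩc : IsPreconnected Ω :=
    (hfin.countable.isConnected_compl_of_one_lt_rank (by simp)).isPreconnected
  have hanal : ∀ {h}, h ∈ repRegular n (Multiplicative (ℤ × ℤ)) →
      AnalyticOnNhd ℂ (fun z => h (γ z)) Ω := by
    intro h hh
    refine DifferentiableOn.analyticOnNhd (fun z hz => ?_) hΩ
    refine (differentiableAt_of_entryDiff b ?_ ?_ hh).differentiableWithinAt
    · refine (entryDiff_expConj_line (e := e₁) (e' := e₁' - e₁) hz).congr ?_
      filter_upwards [hΩ.mem_nhds hz] with w hw using (hγ w hw).1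
    · refine (entryDiff_expConj_line (e := e₂) (e' := e₂' - e₂) hz).congr ?_
      filter_upwards [hΩ.mem_nhds hz] with w hw using (hγ w hw).2
  have h0 : (0 : ℂ) ∈ Ω := by simpa [Ω] using hP
  have h1 : (1 : ℂ) ∈ Ω := by simpa [Ω] using hP'
  have hγ0 : γ 0 = σ := by
    refine rep_ext b ?_ ?_
    · rw [(hγ 0 h0).1, hσA]; simp
    · rw [(hγ 0 h0).2, hσB]; simp
  have hγ1 : γ 1 = τ := by
    refine rep_ext b ?_ ?_
    · rw [(hγ 1 h1).1, hτA]; simp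
    · rw [(hγ 1 h1).2, hτB]; simp
  rcases (hanal hf).eq_zero_or_eq_zero_of_mul_eq_zero (hanal hg) (fun z hz => hfg _
    ⟨_, _, _, hz, hsum he₁ he₁' z, hsum he₂ he₂' z, (hγ z hz).1, (hγ z hz).2⟩) hΩc with h | h
  · exact hfσ (by rw [← hγ0]; exact h 0 h0)
  · exact hgτ (by rw [← hγ1]; exact h 1 h1)

theorem mem_diagonalizableReps (hn : n ≠ 0) {σ : Rep n (Multiplicative (ℤ × ℤ))}
    {M : Matrix (Fin n) (Fin n) ℂ} (hM : M.charpoly.Separable) (c : Fin n → ℂ)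
    (hA : matA b σ = normalizeDet M) (hB : matB b σ = normalizeDet (∑ i, c i • M ^ (i : ℕ))) :
    σ ∈ diagonalizableReps b n := by
  obtain ⟨P, d, hP, rfl⟩ := exists_eq_conj_diagonal hM
  have key : ∀ (N : Matrix (Fin n) (Fin n) ℂ) (d : Fin n → ℂ), N.det = 1 →
      N = normalizeDet (P * diagonal d * P⁻¹) → ∃ e : Fin n → ℂ, ∑ i, e i = 0 ∧ N = expConj P e := by
    intro N d hN hNd
    obtain ⟨s, hs⟩ : ∃ s : ℂ, N = P * diagonal (s • d) * P⁻¹ :=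
      ⟨_, by rw [hNd, normalizeDet, diagonal_smul, mul_smul_comm, smul_mul_assoc]⟩
    rw [hs, det_conj_diagonal hP] at hN
    obtain ⟨e, he, hde⟩ := exists_exp_eq_of_prod_eq_one hn hN
    exact ⟨e, he, by rw [hs, hde, expConj]⟩
  rw [sum_smul_conj_pow hP] at hB
  obtain ⟨e, he, heA⟩ := key _ _ (det_matA b σ) hA
  obtain ⟨f, hf, hfB⟩ := key _ _ (det_matB b σ) hB
  exact ⟨P, e, f, hP, he, hf, heA, hfB⟩

/-- With `B = p(A)`, the pairs `(A + z D, p(A + z D))`, normalized, are diagonalizable for small `z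
≠ 0`; a regular function vanishing on them vanishes at `z = 0` by continuity. -/
theorem mem_closure_diagonalizableReps (hn : n ≠ 0) {σ : Rep n (Multiplicative (ℤ × ℤ))}
    {v : Fin n → ℂ} (hv : (krylov (matA b σ) v).det ≠ 0) :
    σ ∈ @closure _ (AffineVar.zariski (repRegular n (Multiplicative (ℤ × ℤ))))
      (diagonalizableReps b n) := by
  rw [AffineVar.mem_closure_zariski_iff]
  intro f hf hfW
  obtain ⟨c, hc⟩ := exists_eq_sum_smul_pow hv (commute_matA_matB b σ)
  obtain ⟨D, hD⟩ := eventually_separable_charpoly_add_smul (matA b σ)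
  have hM : EntryDiff (fun z => matA b σ + z • D) 0 :=
    (EntryDiff.const _ 0).add (EntryDiff.smul differentiableAt_id (EntryDiff.const D 0))
  have hN : EntryDiff (fun z => ∑ i, c i • (matA b σ + z • D) ^ (i : ℕ)) 0 :=
    EntryDiff.sum _ fun i _ => EntryDiff.smul (differentiableAt_const _) (hM.pow _)
  obtain ⟨γ, hγ0, hγ, hγA, hγB⟩ := exists_curve b hn σ hM hN
    (fun z => commute_sum_smul_pow _ c) (by simp) (by simp [hc.symm])
  have hcont := (differentiableAt_of_entryDiff b hγA hγB hf).continuousAt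
  have hzero : ∀ᶠ z in nhdsWithin (0 : ℂ) {0}ᶜ, f (γ z) = 0 := by
    filter_upwards [hD, nhdsWithin_le_nhds hγ] with z hz hγz
    exact hfW _ (mem_diagonalizableReps b hn hz c hγz.1 hγz.2)
  have hlim : Filter.Tendsto (fun z => f (γ z)) (nhdsWithin (0 : ℂ) {0}ᶜ) (nhds (f (γ 0))) :=
    hcont.tendsto.mono_left nhdsWithin_le_nhds
  rw [← hγ0]
  exact tendsto_nhds_unique hlim (tendsto_const_nhds.congr' (hzero.mono fun z hz => hz.symm))

end RepVar

/-! ### Algebraic dependence of all entries on the chosen coordinates. -/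

section AlgebraicEntries

open Matrix

theorem algHom_det_krylov {n : ℕ} {R : Type*} [CommRing R] [Algebra ℂ R] (f : R →ₐ[ℂ] ℂ)
    (A : Matrix (Fin n) (Fin n) R) (v : Fin n → ℂ) :
    f (krylov A (algebraMap ℂ R ∘ v)).det = (krylov (A.map f) v).det := by
  have h := map_krylov (f : R →+* ℂ) A (algebraMap ℂ R ∘ v)
  have hv : (f : R →+* ℂ) ∘ algebraMap ℂ R ∘ v = v := funext fun i => f.commutes (v i)
  rw [hv] at h
  rw [AlgHom.map_det]
  exact congrArg Matrix.det h

theorem algHom_krylovCoeff {n : ℕ} {R : Type*} [CommRing R] [Algebra ℂ R] (f : R →ₐ[ℂ] ℂ)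
    (A B : Matrix (Fin n) (Fin n) R) (v : Fin n → ℂ) (i : Fin n) :
    f (krylovCoeff A (algebraMap ℂ R ∘ v) B i) = krylovCoeff (A.map f) v (B.map f) i := by
  have h := map_krylovCoeff (f : R →+* ℂ) A B (algebraMap ℂ R ∘ v) i
  have hv : (f : R →+* ℂ) ∘ algebraMap ℂ R ∘ v = v := funext fun i => f.commutes (v i)
  rw [hv] at h
  exact h

/-- Only two scalars are missing: `A o o`, recovered from `det A = 1`, and the constant coefficient
of `B`, recovered from `det B = 1`. Since `o` is the index `0`, that coefficient multiplies `A ^ 0 =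
1`, so it too is a scalar shift. -/
theorem isAlgebraic_entries {n : ℕ} (o : Fin n) (ho : (o : ℕ) = 0) {R : Type*} [CommRing R] [IsDomain R] [Algebra ℂ R]
    {A B : Matrix (Fin n) (Fin n) R} {v : Fin n → ℂ} (hA : A.det = 1) (hB : B.det = 1)
    (hAB : Commute A B) (hdet : (krylov A (algebraMap ℂ R ∘ v)).det ≠ 0) (S₀ : Subalgebra ℂ R)
    (h₁ : ∀ i j, A i j - (if i = j then A o o else 0) ∈ S₀)
    (h₂ : ∀ i, i ≠ o → krylovCoeff A (algebraMap ℂ R ∘ v) B i ∈ S₀) (i j : Fin n) :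
    IsAlgebraic S₀ (A i j) ∧ IsAlgebraic S₀ (B i j) := by
  have hn : n ≠ 0 := (Fin.pos o).ne'
  set w : Fin n → R := algebraMap ℂ R ∘ v with hw
  let T := Subalgebra.algebraicClosure S₀ R
  have hS₀ : ∀ {x : R}, x ∈ S₀ → x ∈ T := fun {x} hx => isAlgebraic_algebraMap (⟨x, hx⟩ : S₀)
  have hT : ∀ {x : R}, IsIntegral T x → x ∈ T := by
    intro x hx
    by_contra hcon
    exact (Transcendental.subalgebraAlgebraicClosure hcon) hx.isAlgebraic
  have hoo : A o o ∈ T := by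
    refine hT (isIntegral_of_det_add_smul_one_mem hn T
      (.of fun i j => A i j - (if i = j then A o o else 0)) (fun i j => hS₀ (h₁ i j)) _ ?_)
    have h : (.of fun i j => A i j - (if i = j then A o o else 0)) +
        A o o • (1 : Matrix (Fin n) (Fin n) R) = A := by
      ext i j
      simp only [Matrix.add_apply, Matrix.smul_apply, Matrix.of_apply, Matrix.one_apply]
      split_ifs <;> simp
    rw [h, hA]
    exact T.one_mem
  have hAT : ∀ i j, A i j ∈ T := by
    intro i j
    rw [← sub_add_cancel (A i j) (if i = j then A o o else 0)]
    refine T.add_mem (hS₀ (h₁ i j)) ?_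
    split_ifs
    · exact hoo
    · exact T.zero_mem
  let A' : Matrix (Fin n) (Fin n) T := .of fun i j => ⟨A i j, hAT i j⟩
  have hA' : A'.map (algebraMap T R) = A := rfl
  have hpow : ∀ (k : ℕ) i j, (A ^ k) i j ∈ T := by
    intro k i j
    have h : A ^ k = (A' ^ k).map (algebraMap T R) :=
      (map_pow (algebraMap T R).mapMatrix A' k).symm
    rw [h]
    exact ((A' ^ k) i j).2
  have hwT : ∀ i, w i ∈ T := fun i => hS₀ (S₀.algebraMap_mem (v i))
  have hdetT : (krylov A w).det ∈ T := by
    have h : (krylov A w).det = algebraMap T R (krylov A' fun i => ⟨w i, hwT i⟩).det := by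
      rw [RingHom.map_det, RingHom.mapMatrix_apply, map_krylov, hA']
      rfl
    rw [h]
    exact Subtype.property _
  have hsum := sum_krylovCoeff_smul_pow hdet hAB
  have hcoeff : ∀ i, krylovCoeff A w B i ∈ T := by
    intro i
    by_cases hi : i = o
    · subst hi
      refine hT (isIntegral_of_det_add_smul_one_mem hn T
        (∑ k ∈ Finset.univ.erase i, krylovCoeff A w B k • A ^ (k : ℕ)) ?_ _ ?_)
      · intro k l
        rw [Matrix.sum_apply]
        refine T.sum_mem fun m hm => ?_
        rw [Matrix.smul_apply, smul_eq_mul]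
        exact T.mul_mem (hS₀ (h₂ m (Finset.ne_of_mem_erase hm))) (hpow _ _ _)
      · have h := Finset.sum_erase_add Finset.univ
          (fun k : Fin n => krylovCoeff A w B k • A ^ (k : ℕ)) (Finset.mem_univ i)
        rw [ho, pow_zero] at h
        rw [h, hsum, Matrix.det_smul, hB, mul_one]
        exact T.pow_mem hdetT _
    · exact hS₀ (h₂ i hi)
  refine ⟨hAT i j, ?_⟩
  have hBT : (krylov A w).det * B i j ∈ T := by
    have h := congrFun (congrFun hsum i) j
    rw [Matrix.smul_apply, smul_eq_mul, Matrix.sum_apply] at h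
    rw [← h]
    exact T.sum_mem fun k _ => T.mul_mem (hcoeff k) (hpow k i j)
  -- The coefficients carry the factor `det (krylov A w)`; cancelling it keeps `B i j` algebraic,
  -- not necessarily integral.
  exact IsAlgebraic.of_mul (mem_nonZeroDivisors_of_ne_zero hdet) hdetT hBT

end AlgebraicEntries

/-! ### Dimension of the main component. -/

namespace RepVar

open Matrix

variable {n : ℕ} (b : Module.Basis (Fin 2) ℤ (ℤ × ℤ))

instance finiteType_repRegular : Algebra.FiniteType ℂ (repRegular n (Multiplicative (ℤ × ℤ))) := by
  rw [← Subalgebra.fg_iff_finiteType, repRegular_eq_adjoin (Module.Basis.finTwoProd ℤ)]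
  exact Subalgebra.fg_def.mpr
    ⟨_, (Set.finite_range _).union (Set.finite_range _), rfl⟩

instance finiteType_coordRing (Z : Set (Rep n (Multiplicative (ℤ × ℤ)))) :
    Algebra.FiniteType ℂ (AffineVar.coordRing (repRegular n (Multiplicative (ℤ × ℤ))) Z) :=
  Algebra.FiniteType.of_surjective _ (AffineVar.restrictReg_surjective _ Z)

/-- The matrix of regular functions `matA`. -/
noncomputable def regA (n : ℕ) :
    Matrix (Fin n) (Fin n) (repRegular n (Multiplicative (ℤ × ℤ))) :=
  .of fun i j => ⟨fun σ => matA b σ i j, Algebra.subset_adjoin ⟨_, i, j, rfl⟩⟩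

/-- The matrix of regular functions `matB`. -/
noncomputable def regB (n : ℕ) :
    Matrix (Fin n) (Fin n) (repRegular n (Multiplicative (ℤ × ℤ))) :=
  .of fun i j => ⟨fun σ => matB b σ i j, Algebra.subset_adjoin ⟨_, i, j, rfl⟩⟩

theorem mem_of_regA_mem_of_regB_mem (T : Subalgebra ℂ (repRegular n (Multiplicative (ℤ × ℤ))))
    (hA : ∀ i j, regA b n i j ∈ T) (hB : ∀ i j, regB b n i j ∈ T)
    (f : repRegular n (Multiplicative (ℤ × ℤ))) : f ∈ T := by
  have hT : ∀ f ∈ Algebra.adjoin ℂ (entryFns b n), ∃ h : f ∈ repRegular n _, ⟨f, h⟩ ∈ T := by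
    intro f hf
    induction hf using Algebra.adjoin_induction with
    | mem f hf =>
      rcases hf with ⟨⟨i, j⟩, rfl⟩ | ⟨⟨i, j⟩, rfl⟩
      · exact ⟨(regA b n i j).2, hA i j⟩
      · exact ⟨(regB b n i j).2, hB i j⟩
    | algebraMap r => exact ⟨Subalgebra.algebraMap_mem _ r, T.algebraMap_mem r⟩
    | add f g _ _ ihf ihg => exact ⟨Subalgebra.add_mem _ ihf.1 ihg.1, T.add_mem ihf.2 ihg.2⟩
    | mul f g _ _ ihf ihg => exact ⟨Subalgebra.mul_mem _ ihf.1 ihg.1, T.mul_mem ihf.2 ihg.2⟩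
  exact (hT f (by rw [← repRegular_eq_adjoin b]; exact f.2)).2

theorem map_evalAt_regA (σ : Rep n (Multiplicative (ℤ × ℤ))) :
    (regA b n).map (AffineVar.evalAt _ σ) = matA b σ := rfl

theorem map_evalAt_regB (σ : Rep n (Multiplicative (ℤ × ℤ))) :
    (regB b n).map (AffineVar.evalAt _ σ) = matB b σ := rfl

/-- The regular function `det (krylov A v)`. -/
noncomputable def krylovDet (v : Fin n → ℂ) : repRegular n (Multiplicative (ℤ × ℤ)) :=
  (krylov (regA b n) (algebraMap ℂ _ ∘ v)).det

theorem krylovDet_apply (v : Fin n → ℂ) (σ : Rep n (Multiplicative (ℤ × ℤ))) :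
    (krylovDet b v : Rep n (Multiplicative (ℤ × ℤ)) → ℂ) σ = (krylov (matA b σ) v).det := by
  rw [← map_evalAt_regA, ← AffineVar.evalAt_apply, krylovDet, algHom_det_krylov]

/-- The irreducible component of the representations in the closure of the diagonalizable ones. -/
def mainComponent (n : ℕ) : Set (Rep n (Multiplicative (ℤ × ℤ))) :=
  @closure _ (AffineVar.zariski (repRegular n (Multiplicative (ℤ × ℤ)))) (diagonalizableReps b n)

theorem mem_components_iff_eq_mainComponent (hn : n ≠ 0) {ρ : Rep n (Multiplicative (ℤ × ℤ))}
    {v : Fin n → ℂ} (hv : (krylov (matA b ρ) v).det ≠ 0) (C : Set (Rep n (Multiplicative (ℤ × ℤ)))) :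
    (C ∈ AffineVar.components (repRegular n (Multiplicative (ℤ × ℤ))) ∧ ρ ∈ C) ↔
      C = mainComponent b n := by
  refine (isPrimeSet_diagonalizableReps b).mem_components_iff (krylovDet b v).2 ?_ ?_ C
  · rwa [krylovDet_apply]
  · intro σ hσ
    rw [krylovDet_apply] at hσ
    exact mem_closure_diagonalizableReps b hn hσ

/-- The matrix of coordinate functions on the component. -/
noncomputable def compA (n : ℕ) : Matrix (Fin n) (Fin n)
    (AffineVar.coordRing (repRegular n (Multiplicative (ℤ × ℤ))) (mainComponent b n)) :=
  (regA b n).map (AffineVar.restrictReg _ _)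

/-- The matrix of coordinate functions on the component. -/
noncomputable def compB (n : ℕ) : Matrix (Fin n) (Fin n)
    (AffineVar.coordRing (repRegular n (Multiplicative (ℤ × ℤ))) (mainComponent b n)) :=
  (regB b n).map (AffineVar.restrictReg _ _)

theorem map_evalAt_compA (σ : mainComponent b n) :
    (compA b n).map (AffineVar.evalAt _ σ) = matA b σ.1 := rfl

theorem map_evalAt_compB (σ : mainComponent b n) :
    (compB b n).map (AffineVar.evalAt _ σ) = matB b σ.1 := rfl

theorem compMatrix_ext {M N : Matrix (Fin n) (Fin n)
    (AffineVar.coordRing (repRegular n (Multiplicative (ℤ × ℤ))) (mainComponent b n))}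
    (h : ∀ σ : mainComponent b n, M.map (AffineVar.evalAt _ σ) = N.map (AffineVar.evalAt _ σ)) :
    M = N := by
  ext1 i j
  exact AffineVar.ext_evalAt fun σ => congrFun (congrFun (h σ) i) j

/-- Coordinates on the component: the entries of `A` up to a shift, and all but the first of the
coefficients of `B` as a polynomial in `A`. -/
noncomputable def compCoord (o : Fin n) (v : Fin n → ℂ) :
    {p : Fin n × Fin n // p ≠ (o, o)} ⊕ {i : Fin n // i ≠ o} →
      AffineVar.coordRing (repRegular n (Multiplicative (ℤ × ℤ))) (mainComponent b n)
  | .inl p => compA b n p.1.1 p.1.2 - if p.1.1 = p.1.2 then compA b n o o else 0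
  | .inr i => krylovCoeff (compA b n) (algebraMap ℂ _ ∘ v) (compB b n) i

theorem evalAt_krylovCoeff (v : Fin n → ℂ) (i : Fin n) (σ : mainComponent b n) :
    AffineVar.evalAt _ σ (krylovCoeff (compA b n) (algebraMap ℂ _ ∘ v) (compB b n) i) =
      krylovCoeff (matA b σ.1) v (matB b σ.1) i :=
  algHom_krylovCoeff _ _ _ v i

theorem evalAt_det_krylov (v : Fin n → ℂ) (σ : mainComponent b n) :
    AffineVar.evalAt _ σ (krylov (compA b n) (algebraMap ℂ _ ∘ v)).det =
      (krylov (matA b σ.1) v).det :=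
  algHom_det_krylov _ _ v

/-- Every value of the coordinates outside the zero set of `Q` is attained on the component, so a
nonzero polynomial cannot vanish identically on them. -/
theorem algebraicIndependent_compCoord (o : Fin n) (ho : (o : ℕ) = 0) {v : Fin n → ℂ}
    {ρ : Rep n (Multiplicative (ℤ × ℤ))} (hv : (krylov (matA b ρ) v).det ≠ 0) :
    AlgebraicIndependent ℂ (compCoord b o v) := by
  have hn : n ≠ 0 := (Fin.pos o).ne'
  rw [algebraicIndependent_iff]
  intro p hp
  by_contra hp0
  let ι := {p : Fin n × Fin n // p ≠ (o, o)} ⊕ {i : Fin n // i ≠ o}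
  let G : Matrix (Fin n) (Fin n) (MvPolynomial ι ℂ) := .of fun i j =>
    if h : (i, j) ≠ (o, o) then MvPolynomial.X (Sum.inl ⟨(i, j), h⟩) else 0
  let Q : MvPolynomial ι ℂ := (krylov G (MvPolynomial.C ∘ v)).det
  let S : (ι → ℂ) → Matrix (Fin n) (Fin n) ℂ := fun c => G.map (MvPolynomial.eval c)
  have hS : ∀ c i j, S c i j = if h : (i, j) ≠ (o, o) then c (Sum.inl ⟨(i, j), h⟩) else 0 := by
    intro c i j
    simp only [S, G, Matrix.map_apply, Matrix.of_apply]
    split_ifs <;> simp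
  have hQ : ∀ c, MvPolynomial.eval c Q = (krylov (S c) v).det := by
    intro c
    rw [RingHom.map_det, RingHom.mapMatrix_apply, map_krylov]
    congr 2
    ext i
    simp
  -- `Q` is nonzero at the shifted matrix of `ρ`, as the shift leaves the Krylov determinant
  -- unchanged.
  have hQ0 : Q ≠ 0 := by
    intro h
    let c : ι → ℂ := Sum.elim (fun p => matA b ρ p.1.1 p.1.2 -
      if p.1.1 = p.1.2 then matA b ρ o o else 0) 0
    have hc : matA b ρ = S c + matA b ρ o o • (1 : Matrix (Fin n) (Fin n) ℂ) := by
      ext i j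
      rw [Matrix.add_apply, hS, Matrix.smul_apply, Matrix.one_apply]
      by_cases hij : (i, j) = (o, o)
      · obtain ⟨rfl, rfl⟩ := Prod.mk.inj hij
        simp
      · rw [dif_pos hij]
        by_cases h' : i = j <;> simp [c, h']
    apply hv
    rw [hc, krylov_add_smul_one_det, ← hQ, h, map_zero]
  obtain ⟨c, hc⟩ : ∃ c, MvPolynomial.eval c (p * Q) ≠ 0 := by
    by_contra! hcon
    exact mul_ne_zero hp0 hQ0 (MvPolynomial.funext fun c => by rw [hcon c, map_zero])
  rw [map_mul, mul_ne_zero_iff] at hc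
  obtain ⟨x, hx⟩ := exists_det_add_smul_one_eq hn (S c) 1
  set A := S c + x • (1 : Matrix (Fin n) (Fin n) ℂ) with hA
  have hKA : (krylov A v).det ≠ 0 := by rw [hA, krylov_add_smul_one_det, ← hQ]; exact hc.2
  -- Division by the Krylov determinant compensates the factor in `krylovCoeff`; the free constant
  -- coefficient is then fixed by `det = 1`.
  let u : Fin n → ℂ := fun i => if h : i ≠ o then (krylov A v).det⁻¹ * c (Sum.inr ⟨i, h⟩) else 0
  obtain ⟨y, hy⟩ := exists_det_add_smul_one_eq hn (∑ i, u i • A ^ (i : ℕ)) 1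
  let u' : Fin n → ℂ := u + Pi.single o y
  have hu : ∑ i, u i • A ^ (i : ℕ) + y • (1 : Matrix (Fin n) (Fin n) ℂ) =
      ∑ i, u' i • A ^ (i : ℕ) := by
    simp only [u', Pi.add_apply, add_smul, Finset.sum_add_distrib]
    congr 1
    rw [Finset.sum_eq_single o (fun i _ hi => by simp [hi]) (by simp)]
    simp [ho]
  rw [hu] at hy
  let σ := mkRep b ⟨A, hx⟩ ⟨_, hy⟩ (Subtype.ext (commute_sum_smul_pow A _).eq)
  have hσA : matA b σ = A := matA_mkRep b _ _ _
  have hσB : matB b σ = ∑ i, u' i • A ^ (i : ℕ) := matB_mkRep b _ _ _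
  have hσ : σ ∈ mainComponent b n :=
    mem_closure_diagonalizableReps b hn (v := v) (by rw [hσA]; exact hKA)
  have heval : ∀ k, AffineVar.evalAt _ ⟨σ, hσ⟩ (compCoord b o v k) = c k := by
    rintro (⟨⟨i, j⟩, hij⟩ | ⟨i, hi⟩)
    · have h1 : AffineVar.evalAt _ ⟨σ, hσ⟩ (compCoord b o v (Sum.inl ⟨(i, j), hij⟩)) =
          matA b σ i j - if i = j then matA b σ o o else 0 := by
        simp only [compCoord, map_sub]
        split_ifs
        · rfl
        · rw [map_zero]
          rfl
      rw [h1, hσA, hA]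
      simp only [Matrix.add_apply, Matrix.smul_apply, hS, dif_pos hij, Matrix.one_apply]
      by_cases h' : i = j <;> simp [h']
    · simp only [compCoord]
      rw [evalAt_krylovCoeff, hσA, hσB, krylovCoeff_sum_smul_pow]
      simp [u', u, hi, hKA]
  apply hc.1
  have h := congrArg (AffineVar.evalAt _ ⟨σ, hσ⟩) hp
  rw [← AlgHom.comp_apply, MvPolynomial.comp_aeval, funext heval, map_zero] at h
  simpa [MvPolynomial.aeval_eq_eval] using h

theorem card_compCoord_index (o : Fin n) :
    Nat.card ({p : Fin n × Fin n // p ≠ (o, o)} ⊕ {i : Fin n // i ≠ o}) = (n + 2) * (n - 1) := by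
  rw [Nat.card_eq_fintype_card, Fintype.card_sum, Fintype.card_subtype_compl,
    Fintype.card_subtype_compl, Fintype.card_subtype_eq, Fintype.card_subtype_eq, Fintype.card_prod,
    Fintype.card_fin]
  obtain ⟨m, rfl⟩ := Nat.exists_eq_succ_of_ne_zero (Fin.pos o).ne'
  simp only [Nat.succ_eq_add_one, Nat.add_sub_cancel]
  rw [show (m + 1) * (m + 1) = (m + 2) * m + 1 by ring, Nat.add_sub_cancel]
  ring

theorem dim_mainComponent (hn : 1 ≤ n) {v : Fin n → ℂ} {ρ : Rep n (Multiplicative (ℤ × ℤ))}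
    (hv : (krylov (matA b ρ) v).det ≠ 0) :
    AffineVar.dim (repRegular n (Multiplicative (ℤ × ℤ))) (mainComponent b n) =
      (((n + 2) * (n - 1) : ℕ) : WithBot ℕ∞) := by
  have hn0 : n ≠ 0 := by omega
  let o : Fin n := ⟨0, hn⟩
  let ρ' : mainComponent b n := ⟨ρ, mem_closure_diagonalizableReps b hn0 hv⟩
  let R := AffineVar.coordRing (repRegular n (Multiplicative (ℤ × ℤ))) (mainComponent b n)
  have : NoZeroDivisors R := (isPrimeSet_diagonalizableReps b).noZeroDivisors
  have : Nontrivial R := ⟨0, 1, fun h => by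
    have := congrArg (AffineVar.evalAt R ρ') h
    simp at this⟩
  have : IsDomain R := NoZeroDivisors.to_isDomain R
  have hind := algebraicIndependent_compCoord b o rfl hv
  have hbasis : IsTranscendenceBasis ℂ (compCoord b o v) := by
    rw [isTranscendenceBasis_iff_algebraicIndependent_isAlgebraic]
    refine ⟨hind, ⟨?_⟩⟩
    set S₀ := Algebra.adjoin ℂ (Set.range (compCoord b o v))
    have hmem : ∀ k, compCoord b o v k ∈ S₀ := fun k => Algebra.subset_adjoin ⟨k, rfl⟩
    have hAdet : (compA b n).det = 1 := AffineVar.ext_evalAt fun σ => by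
      rw [AlgHom.map_det, AlgHom.mapMatrix_apply, map_evalAt_compA, det_matA, map_one]
    have hBdet : (compB b n).det = 1 := AffineVar.ext_evalAt fun σ => by
      rw [AlgHom.map_det, AlgHom.mapMatrix_apply, map_evalAt_compB, det_matB, map_one]
    have hcomm : Commute (compA b n) (compB b n) := compMatrix_ext b fun σ => by
      rw [Matrix.map_mul, Matrix.map_mul, map_evalAt_compA, map_evalAt_compB]
      exact commute_matA_matB b σ.1
    have hdet : (krylov (compA b n) (algebraMap ℂ R ∘ v)).det ≠ 0 := by
      intro h
      apply hv
      rw [← evalAt_det_krylov b v ρ', h, map_zero]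
    have hall := isAlgebraic_entries o rfl hAdet hBdet hcomm hdet S₀
      (fun i j => by
        by_cases hij : (i, j) = (o, o)
        · obtain ⟨rfl, rfl⟩ := Prod.mk.inj hij
          simp
        · exact hmem (Sum.inl ⟨(i, j), hij⟩))
      (fun i hi => hmem (Sum.inr ⟨i, hi⟩))
    intro r
    obtain ⟨f, rfl⟩ := AffineVar.restrictReg_surjective _ _ r
    exact mem_of_regA_mem_of_regB_mem b
      (((Subalgebra.algebraicClosure S₀ R).restrictScalars ℂ).comap (AffineVar.restrictReg _ _))
      (fun i j => (hall i j).1) (fun i j => (hall i j).2) f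
  rw [AffineVar.dim, ringKrullDim_eq_card_of_isTranscendenceBasis hbasis]
  rw [card_compCoord_index]

end RepVar

/-! ### Trace-zero matrices and the linearized determinant. -/

section TraceZero

open Matrix

variable {n : ℕ}

theorem finrank_inf_ker_trace (hn : n ≠ 0) (V : Submodule ℂ (Matrix (Fin n) (Fin n) ℂ))
    (hV : 1 ∈ V) :
    Module.finrank ℂ ↥(V ⊓ LinearMap.ker (Matrix.traceLinearMap (Fin n) ℂ ℂ)) =
      Module.finrank ℂ V - 1 := by
  let t : V →ₗ[ℂ] ℂ := (Matrix.traceLinearMap (Fin n) ℂ ℂ).domRestrict V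
  have ht : Function.Surjective t := by
    intro z
    refine ⟨(z / n) • ⟨1, hV⟩, ?_⟩
    have hn' : (n : ℂ) ≠ 0 := Nat.cast_ne_zero.mpr hn
    rw [map_smul]
    simp [t, hn']
  have h := t.finrank_range_add_finrank_ker
  rw [LinearMap.range_eq_top.mpr ht, finrank_top, Module.finrank_self] at h
  have hker : V ⊓ LinearMap.ker (Matrix.traceLinearMap (Fin n) ℂ ℂ) =
      (LinearMap.ker t).map V.subtype := by
    rw [show LinearMap.ker t = (LinearMap.ker (Matrix.traceLinearMap (Fin n) ℂ ℂ)).comap V.subtype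
      from rfl, Submodule.map_comap_subtype]
  rw [hker, Submodule.finrank_map_subtype_eq]
  omega

/-- Factoring out `A`, the `ε`-part of the determinant is the trace of `A⁻¹ D`. -/
theorem trace_adjugate_mul_eq_zero {A D : Matrix (Fin n) (Fin n) ℂ} (hA : A.det = 1)
    (h : (A.map (TrivSqZeroExt.inl : ℂ → DualNumber ℂ) +
      (DualNumber.eps : DualNumber ℂ) • D.map TrivSqZeroExt.inl).det = 1) :
    (A.adjugate * D).trace = 0 := by
  let ι : ℂ →+* DualNumber ℂ := TrivSqZeroExt.inlHom ℂ ℂ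
  have hAD : A * (A.adjugate * D) = D := by rw [← mul_assoc, mul_adjugate, hA, one_smul, one_mul]
  have h1 : A.map ι + (DualNumber.eps : DualNumber ℂ) • D.map ι =
      A.map ι * (1 + (DualNumber.eps : DualNumber ℂ) • (A.adjugate * D).map ι) := by
    conv_lhs => rw [← hAD]
    rw [Matrix.map_mul, mul_add, mul_one, mul_smul_comm]
  have h2 : (A.map ι).det = 1 := by
    rw [← RingHom.mapMatrix_apply, ← RingHom.map_det, hA, map_one]
  change (A.map ι + (DualNumber.eps : DualNumber ℂ) • D.map ι).det = 1 at h
  rw [h1, det_mul, h2, one_mul, Matrix.det_one_add_smul, pow_two, DualNumber.eps_mul_eps, mul_zero,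
    add_zero, add_eq_left] at h
  have htr : ((A.adjugate * D).map ι).trace = ι (A.adjugate * D).trace :=
    (map_sum ι _ _).symm
  rw [htr] at h
  have h3 := congrArg TrivSqZeroExt.snd h
  simpa [ι] using h3

end TraceZero

/-! ### The Zariski tangent space. -/

namespace AffineVar

variable {X : Type*} {𝒪 : Subalgebra ℂ (X → ℂ)}

/-- The homomorphism to the dual numbers defined by a tangent vector. -/
def dualNumberHom {x : X} (w : tangentSpace 𝒪 x) : 𝒪 →+* DualNumber ℂ where
  toFun f := TrivSqZeroExt.inl ((f : X → ℂ) x) + TrivSqZeroExt.inr (w.1 f)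
  map_one' := by
    have h : w.1 1 = 0 := by simpa using w.2 1 1
    simp [h]
  map_zero' := by simp
  map_add' f g := by
    ext <;> simp
  map_mul' f g := by
    have h := w.2 f g
    ext
    · simp
    · simp [h, mul_comm]

/-- A tangent vector annihilates a subalgebra. -/
def annihilated {x : X} (w : tangentSpace 𝒪 x) : Subalgebra ℂ 𝒪 where
  carrier := {f | w.1 f = 0}
  mul_mem' {f g} hf hg := by
    rw [Set.mem_ofPred_eq] at *
    rw [w.2, hf, hg, mul_zero, mul_zero, add_zero]
  add_mem' {f g} hf hg := by
    rw [Set.mem_ofPred_eq] at *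
    rw [map_add, hf, hg, add_zero]
  algebraMap_mem' r := by
    have h : w.1 1 = 0 := by simpa using w.2 1 1
    rw [Set.mem_ofPred_eq, Algebra.algebraMap_eq_smul_one, map_smul, h, smul_zero]

end AffineVar

namespace RepVar

open Matrix

variable {n : ℕ} (b : Module.Basis (Fin 2) ℤ (ℤ × ℤ)) (ρ : Rep n (Multiplicative (ℤ × ℤ)))

/-- Tangent vectors at `ρ`. -/
abbrev Tangent : Type :=
  AffineVar.tangentSpace (repRegular n (Multiplicative (ℤ × ℤ))) ρ

/-- The differential of `matA`. -/
noncomputable def diffA : Tangent ρ →ₗ[ℂ] Matrix (Fin n) (Fin n) ℂ where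
  toFun w := .of fun i j => w.1 (regA b n i j)
  map_add' _ _ := rfl
  map_smul' _ _ := rfl

/-- The differential of `matB`. -/
noncomputable def diffB : Tangent ρ →ₗ[ℂ] Matrix (Fin n) (Fin n) ℂ where
  toFun w := .of fun i j => w.1 (regB b n i j)
  map_add' _ _ := rfl
  map_smul' _ _ := rfl

variable {ρ}

theorem eq_zero_of_diffA_of_diffB {w : Tangent ρ} (hA : diffA b ρ w = 0) (hB : diffB b ρ w = 0) :
    w = 0 := by
  ext f
  exact mem_of_regA_mem_of_regB_mem b (AffineVar.annihilated w)
    (fun i j => congrFun (congrFun hA i) j) (fun i j => congrFun (congrFun hB i) j) f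

theorem map_dualNumberHom_regA (w : Tangent ρ) :
    (regA b n).map (AffineVar.dualNumberHom w) = (matA b ρ).map TrivSqZeroExt.inl +
      (DualNumber.eps : DualNumber ℂ) • (diffA b ρ w).map TrivSqZeroExt.inl := by
  ext i j <;> simp [AffineVar.dualNumberHom, regA, diffA]

theorem map_dualNumberHom_regB (w : Tangent ρ) :
    (regB b n).map (AffineVar.dualNumberHom w) = (matB b ρ).map TrivSqZeroExt.inl +
      (DualNumber.eps : DualNumber ℂ) • (diffB b ρ w).map TrivSqZeroExt.inl := by
  ext i j <;> simp [AffineVar.dualNumberHom, regB, diffB]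

theorem det_regA : (regA b n).det = 1 := AffineVar.ext_evalAt fun σ => by
  rw [AlgHom.map_det, AlgHom.mapMatrix_apply, map_evalAt_regA, det_matA, map_one]

theorem det_regB : (regB b n).det = 1 := AffineVar.ext_evalAt fun σ => by
  rw [AlgHom.map_det, AlgHom.mapMatrix_apply, map_evalAt_regB, det_matB, map_one]

theorem commute_regA_regB : Commute (regA b n) (regB b n) := by
  ext1 i j
  refine AffineVar.ext_evalAt fun σ => ?_
  have h := (commute_matA_matB b σ).eq
  rw [← map_evalAt_regA, ← map_evalAt_regB, ← Matrix.map_mul, ← Matrix.map_mul] at h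
  exact congrFun (congrFun h i) j

theorem trace_adjugate_mul_diffA (w : Tangent ρ) : ((matA b ρ).adjugate * diffA b ρ w).trace = 0 := by
  refine trace_adjugate_mul_eq_zero (det_matA b ρ) ?_
  rw [← map_dualNumberHom_regA, ← RingHom.mapMatrix_apply, ← RingHom.map_det, det_regA, map_one]

theorem trace_adjugate_mul_diffB (w : Tangent ρ) : ((matB b ρ).adjugate * diffB b ρ w).trace = 0 := by
  refine trace_adjugate_mul_eq_zero (det_matB b ρ) ?_
  rw [← map_dualNumberHom_regB, ← RingHom.mapMatrix_apply, ← RingHom.map_det, det_regB, map_one]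

/-- This is the `ε`-part of `A B = B A` over the dual numbers when `dA = 0`. -/
theorem commute_matA_diffB {w : Tangent ρ} (hw : diffA b ρ w = 0) :
    Commute (matA b ρ) (diffB b ρ w) := by
  have h := congrArg (AffineVar.dualNumberHom w).mapMatrix (commute_regA_regB b (n := n)).eq
  rw [map_mul, map_mul, RingHom.mapMatrix_apply, RingHom.mapMatrix_apply, map_dualNumberHom_regA,
    map_dualNumberHom_regB, hw] at h
  ext i j
  have h2 := congrArg TrivSqZeroExt.snd (congrFun (congrFun h i) j)
  simpa [mul_apply, TrivSqZeroExt.snd_sum, mul_comm] using h2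

theorem exists_tangent (hn : n ≠ 0) {M N : ℂ → Matrix (Fin n) (Fin n) ℂ} (hM : EntryDiff M 0)
    (hN : EntryDiff N 0) (hMN : ∀ z, Commute (M z) (N z)) (hM0 : M 0 = matA b ρ)
    (hN0 : N 0 = matB b ρ) :
    ∃ w : Tangent ρ,
      (∀ D : Matrix (Fin n) (Fin n) ℂ,
        (∀ i j, HasDerivAt (fun z => normalizeDet (M z) i j) (D i j) 0) → diffA b ρ w = D) ∧
      ∀ D : Matrix (Fin n) (Fin n) ℂ,
        (∀ i j, HasDerivAt (fun z => normalizeDet (N z) i j) (D i j) 0) → diffB b ρ w = D := by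
  obtain ⟨γ, rfl, hγ, hγA, hγB⟩ := exists_curve b hn ρ hM hN hMN hM0 hN0
  refine ⟨velocity b γ hγA hγB, fun D hD => ?_, fun D hD => ?_⟩
  · ext i j
    refine ((hD i j).congr_of_eventuallyEq (hγ.mono fun z hz => ?_)).deriv
    exact congrFun (congrFun hz.1 i) j
  · ext i j
    refine ((hD i j).congr_of_eventuallyEq (hγ.mono fun z hz => ?_)).deriv
    exact congrFun (congrFun hz.2 i) j

theorem adjugate_mul_cancel {A : Matrix (Fin n) (Fin n) ℂ} (hA : A.det = 1)
    (Y : Matrix (Fin n) (Fin n) ℂ) : A.adjugate * (A * Y) = Y := by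
  rw [← mul_assoc, adjugate_mul, hA, one_smul, one_mul]

theorem eq_zero_of_adjugate_mul_eq_zero {A : Matrix (Fin n) (Fin n) ℂ} (hA : A.det = 1)
    {Y : Matrix (Fin n) (Fin n) ℂ} (h : A.adjugate * Y = 0) : Y = 0 := by
  rw [← one_mul Y, ← one_smul ℂ (1 : Matrix (Fin n) (Fin n) ℂ), ← hA, ← mul_adjugate, mul_assoc, h,
    mul_zero]

/-- Rank–nullity for `π`, which is `A⁻¹ dA`: its range has dimension `n² - 1`, and its kernel is
identified by `κ`, that is `B⁻¹ dB`, with the trace-zero part of the commutant, of dimension `n -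
1`. Equations over the dual numbers bound both images; velocities of actual curves fill them. -/
theorem finrank_tangent (hn : 1 ≤ n) {v : Fin n → ℂ} (hv : (krylov (matA b ρ) v).det ≠ 0) :
    Module.Finite ℂ (Tangent ρ) ∧ Module.finrank ℂ (Tangent ρ) = (n + 2) * (n - 1) := by
  have hn0 : n ≠ 0 := by omega
  have hfin : Module.Finite ℂ (Tangent ρ) := by
    refine Module.Finite.of_injective ((diffA b ρ).prod (diffB b ρ)) ?_
    rw [← LinearMap.ker_eq_bot, LinearMap.ker_eq_bot']
    intro w hw
    exact eq_zero_of_diffA_of_diffB b (congrArg Prod.fst hw) (congrArg Prod.snd hw)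
  refine ⟨hfin, ?_⟩
  let π : Tangent ρ →ₗ[ℂ] Matrix (Fin n) (Fin n) ℂ :=
    LinearMap.mulLeft ℂ (matA b ρ).adjugate ∘ₗ diffA b ρ
  let κ : LinearMap.ker π →ₗ[ℂ] Matrix (Fin n) (Fin n) ℂ :=
    (LinearMap.mulLeft ℂ (matB b ρ).adjugate ∘ₗ diffB b ρ) ∘ₗ (LinearMap.ker π).subtype
  have hker : ∀ w, π w = 0 ↔ diffA b ρ w = 0 := fun w =>
    ⟨eq_zero_of_adjugate_mul_eq_zero (det_matA b ρ), fun h => by simp [π, h]⟩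
  obtain ⟨c, hc⟩ := exists_eq_sum_smul_pow hv (commute_matA_matB b ρ)
  have hπ : LinearMap.range π = ⊤ ⊓ LinearMap.ker (Matrix.traceLinearMap (Fin n) ℂ ℂ) := by
    ext Y
    rw [top_inf_eq, LinearMap.mem_ker, Matrix.traceLinearMap_apply]
    constructor
    · rintro ⟨w, rfl⟩
      exact trace_adjugate_mul_diffA b w
    · intro hY
      have hM := EntryDiff.one_add_smul (matA b ρ) Y 0
      -- The curve deforms `A` to `A (1 + z Y)` and carries `B` along as the same polynomial `p`.
      obtain ⟨w, hw, -⟩ := exists_tangent (ρ := ρ) b hn0 hM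
        (EntryDiff.sum Finset.univ fun (i : Fin n) _ =>
          EntryDiff.smul (differentiableAt_const (c i)) (hM.pow i))
        (fun z => commute_sum_smul_pow _ c) (by simp) (by simp [hc.symm])
      refine ⟨w, ?_⟩
      change (matA b ρ).adjugate * diffA b ρ w = Y
      rw [hw (matA b ρ * Y) (hasDerivAt_normalizeDet (det_matA b ρ) hY),
        adjugate_mul_cancel (det_matA b ρ)]
  have hκinj : Function.Injective κ := by
    intro w w' h
    refine Subtype.ext (sub_eq_zero.mp (eq_zero_of_diffA_of_diffB b ?_
      (eq_zero_of_adjugate_mul_eq_zero (det_matB b ρ) ?_)))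
    · rw [map_sub, (hker _).mp w.2, (hker _).mp w'.2, sub_zero]
    · rw [map_sub, mul_sub, sub_eq_zero]
      exact h
  have hκ : LinearMap.range κ =
      commutant (matA b ρ) ⊓ LinearMap.ker (Matrix.traceLinearMap (Fin n) ℂ ℂ) := by
    ext Y
    rw [Submodule.mem_inf, mem_commutant, LinearMap.mem_ker, Matrix.traceLinearMap_apply]
    constructor
    · rintro ⟨w, rfl⟩
      refine ⟨?_, trace_adjugate_mul_diffB b w.1⟩
      have hadj : Commute (matA b ρ) (matB b ρ).adjugate := by
        have h := (commute_matA_matB b ρ).eq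
        have h2 := congrArg (fun Z => (matB b ρ).adjugate * Z * (matB b ρ).adjugate) h
        simp only [← mul_assoc, adjugate_mul, det_matB, one_smul, one_mul] at h2
        rw [mul_assoc, mul_assoc, mul_adjugate, det_matB, one_smul, mul_one] at h2
        exact h2.symm
      exact (hadj.mul_right (commute_matA_diffB b ((hker _).mp w.2))).eq
    · rintro ⟨hYA, hY⟩
      -- Here `A` stays fixed and `B` moves as `B (1 + z Y)`, which commutes with `A` because `Y`
      -- does.
      obtain ⟨w, hwA, hwB⟩ := exists_tangent (ρ := ρ) b hn0 (EntryDiff.one_add_smul (matA b ρ) 0 0)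
        (EntryDiff.one_add_smul (matB b ρ) Y 0)
        (fun z => by
          rw [smul_zero, add_zero, mul_one]
          exact (commute_matA_matB b ρ).mul_right
            ((Commute.one_right _).add_right ((show Commute (matA b ρ) Y from hYA).smul_right z)))
        (by simp) (by simp)
      have hwA' : diffA b ρ w = 0 := by
        rw [hwA _ (hasDerivAt_normalizeDet (det_matA b ρ) (Matrix.trace_zero _ _)), mul_zero]
      refine ⟨⟨w, (hker w).mpr hwA'⟩, ?_⟩
      change (matB b ρ).adjugate * diffB b ρ w = Y
      rw [hwB (matB b ρ * Y) (hasDerivAt_normalizeDet (det_matB b ρ) hY),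
        adjugate_mul_cancel (det_matB b ρ)]
  have h := π.finrank_range_add_finrank_ker
  rw [← LinearMap.finrank_range_of_inj hκinj, hκ, hπ, finrank_inf_ker_trace hn0 ⊤ trivial,
    finrank_inf_ker_trace hn0 _ (mem_commutant.mpr (by simp)), finrank_commutant hv, finrank_top,
    Module.finrank_matrix, Module.finrank_self, Fintype.card_fin] at h
  rw [← h]
  obtain ⟨m, rfl⟩ := Nat.exists_eq_succ_of_ne_zero hn0
  simp only [Nat.succ_eq_add_one, Nat.add_sub_cancel, mul_one]
  rw [show (m + 1) * (m + 1) = (m + 2) * m + 1 by ring, Nat.add_sub_cancel]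
  ring

end RepVar

theorem mainTheorem7 (n : ℕ) (hn : 1 ≤ n)
    (ρ : RepVar.Rep n (Multiplicative (ℤ × ℤ))) (μ : ℤ × ℤ)
    (hμ : RepVar.IsSimpleElement μ)
    (hreg : RepVar.IsRegularElement (ρ (Multiplicative.ofAdd μ))) :
    AffineVar.IsSmoothPoint (RepVar.repRegular n (Multiplicative (ℤ × ℤ))) ρ ∧
      ∃ C ∈ AffineVar.components (RepVar.repRegular n (Multiplicative (ℤ × ℤ))),
        ρ ∈ C ∧
          AffineVar.dim (RepVar.repRegular n (Multiplicative (ℤ × ℤ))) C =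
            (((n + 2) * (n - 1) : ℕ) : WithBot ℕ∞) := by
  obtain ⟨b, rfl⟩ := hμ
  obtain ⟨v, hv⟩ := exists_krylov_det_ne_zero _
    (RepVar.finrank_commutant_le_of_isRegularElement hn hreg)
  have hcomp := RepVar.mem_components_iff_eq_mainComponent b (by omega) hv
  have hdim := RepVar.dim_mainComponent b hn hv
  obtain ⟨hfin, hrank⟩ := RepVar.finrank_tangent b hn hv
  obtain ⟨hC, hρ⟩ := (hcomp _).mpr rfl
  refine ⟨⟨hfin, ?_⟩, _, hC, hρ, hdim⟩
  rw [AffineVar.localDim_eq_of_components hcomp, hdim]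
  exact congrArg _ hrank
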